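/- Let $G$ be a discrete group. All $C^*$-algebras are $\mathbb Z/2$-graded $G$-$C^*$-algebras (a $G$-action by $*$-automorphisms and a commuting involutive grading automorphism $\epsilon$), and all $*$-homomorphisms are $G$-equivariant and grading preserving. For a nonempty directed set $\mathfrak m$ let $|\Delta^{\mathfrak m}|$ be the geometric realization (with the weak topology) of the full simplicial complex with vertex set $\mathfrak m$, and for $m\in\mathfrak m$ let $|\Delta^{\mathfrak m\triangleright m}|$ be the face spanned by $\{n\in\mathfrak m: n\ge m\}$. Put $\mathfrak S^{\mathfrak m}B=C_b(|\Delta^{\mathfrak m}|;B)/C_0(|\Delta^{\mathfrak m}|;B)$, where $C_0$ consists of the bounded continuous $f$ such that for every $\varepsilon>0$ there is $m$ with $\|f|_{|\Delta^{\mathfrak m\triangleright m}|}\|<\varepsilon$. Two $*$-homomorphisms $A\to\mathfrak S^{\mathfrak m}B$ are $\mathfrak m$-homotopic if they are the evaluations at $0$ and $1$ of a $*$-homomorphism $A\to\mathfrak S^{\mathfrak m}C([0,1];B)$; $[[A,B]]_{\mathfrak m}$ is the set of classes, and $[[A,B]]=\varinjlim_{\mathfrak m}[[A,B]]_{\mathfrak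 m}$ is the direct limit over all directed sets along the maps $\alpha^*\colon[[A,B]]_{\mathfrak n}\to[[A,B]]_{\mathfrak m}$ induced by the affine extensions of cofinal maps $\alpha\colon\mathfrak m\to\mathfrak n$ (for each $n$ there is $m$ with $\alpha(k)\ge n$ for all $k\ge m$). Let $\Sigma A=C_0((0,1))\otimes A=C_0((0,1);A)$ with trivial action and grading on $C_0((0,1))$. Let $0\to J\to B\xrightarrow{\pi}A\to0$ be a short exact sequence, with $J$ identified with its image in $B$, and let $J_0\subseteq J$ be a closed $*$-subalgebra, invariant under $G$ and $\epsilon$, such that the linear span of $J_0J$ is dense in $J$ (for example $J_0=J$). A quasicentral approximate unit for $J_0$ in $B$ is a net $(u_m)_{m\in\mathfrak m}$ in $J_0$, indexed by an arbitrary nonempty directed set, with $0\le u_m\le1$, $\|u_mj-j\|\to0$ for all $j\in J_0$, $\|u_mb-bu_m\|\to0$ for all $b\in B$, $\|gu_m-u_m\|\to0$ for all $g\in G$, and $\|\epsilon(u_m)-u_m\|\to0$ (automatic if the grading is trivial or all $u_m$ are even). 1. For every quasicentral approximate unit $(u_m)_{m\in\mathfrak m}$ for $J_0$ in $B$, its affine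 extension $x\mapsto u_x$ to $|\Delta^{\mathfrak m}|$ is continuous, and there is a unique ($G$-equivariant, graded) $*$-homomorphism $\sigma\colon\Sigma A\to\mathfrak S^{\mathfrak m}J$ which for all $f\in C_0((0,1))$ and $b\in B$ maps $f\otimes\pi(b)$ to the class of the bounded continuous function $|\Delta^{\mathfrak m}|\to J$, $x\mapsto f(u_x)b$. 2. The class of $\sigma$ in $[[\Sigma A,J]]$ does not depend on the choice of the quasicentral approximate unit: if $(u_m)_{m\in\mathfrak m}$ and $(v_n)_{n\in\mathfrak n}$ are quasicentral approximate units for $J_0$ in $B$, possibly indexed by different directed sets, then the associated $*$-homomorphisms $\Sigma A\to\mathfrak S^{\mathfrak m}J$ and $\Sigma A\to\mathfrak S^{\mathfrak n}J$ define the same class. -/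

import Mathlib

universe w

open Filter Topology
open scoped BoundedContinuousFunction ZeroAtInfty

noncomputable section

/-! ### Graded `G`-C⋆-algebras and their morphisms -/

/-- A `ℤ/2`-grading and an action of the (discrete) group `G` on a C⋆-algebra `A`: the action is
by ⋆-automorphisms, the grading is an involutive ⋆-automorphism (`1` on the even part, `-1` on the
odd part), and the two commute. -/
class GradedGCStarAlgebra (G : Type*) [Group G] (A : Type*) [NonUnitalCStarAlgebra A] where
  act : G → A →⋆ₙₐ[ℂ] A
  act_one : ∀ a, act 1 a = a
  act_mul : ∀ g h a, act (g * h) a = act g (act h a)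
  grade : A →⋆ₙₐ[ℂ] A
  grade_grade : ∀ a, grade (grade a) = a
  grade_act : ∀ g a, grade (act g a) = act g (grade a)

/-- The action of `g : G` on a graded `G`-C⋆-algebra. -/
def gact {G : Type*} [Group G] {A : Type*} [NonUnitalCStarAlgebra A] [GradedGCStarAlgebra G A]
    (g : G) : A →⋆ₙₐ[ℂ] A := GradedGCStarAlgebra.act g

/-- The grading automorphism of a graded `G`-C⋆-algebra. -/
def gradeAut (G : Type*) [Group G] {A : Type*} [NonUnitalCStarAlgebra A]
    [GradedGCStarAlgebra G A] : A →⋆ₙₐ[ℂ] A := GradedGCStarAlgebra.grade G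

/-- Morphisms of graded `G`-C⋆-algebras: `G`-equivariant, grading preserving ⋆-homomorphisms. -/
@[ext]
structure GStarHom (G : Type*) [Group G] (A B : Type*)
    [NonUnitalCStarAlgebra A] [GradedGCStarAlgebra G A]
    [NonUnitalCStarAlgebra B] [GradedGCStarAlgebra G B] where
  toHom : A →⋆ₙₐ[ℂ] B
  map_act : ∀ (g : G) (a : A), toHom (gact g a) = gact g (toHom a)
  map_grade : ∀ a : A, toHom (gradeAut G a) = gradeAut G (toHom a)

/-- Composition of morphisms. -/
def GStarHom.comp {G : Type*} [Group G] {A B C : Type*}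
    [NonUnitalCStarAlgebra A] [GradedGCStarAlgebra G A]
    [NonUnitalCStarAlgebra B] [GradedGCStarAlgebra G B]
    [NonUnitalCStarAlgebra C] [GradedGCStarAlgebra G C]
    (ψ : GStarHom G B C) (φ : GStarHom G A B) : GStarHom G A C where
  toHom := ψ.toHom.comp φ.toHom
  map_act g a := by simp [φ.map_act, ψ.map_act]
  map_grade a := by simp [φ.map_grade, ψ.map_grade]

/-! ### Function algebras -/

section FunctionAlgebras

variable {B C : Type*} [NonUnitalCStarAlgebra B] [NonUnitalCStarAlgebra C]

theorem starHom_lipschitz (φ : B →⋆ₙₐ[ℂ] C) : LipschitzWith 1 φ :=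
  LipschitzWith.of_dist_le_mul fun a b => by
    rw [dist_eq_norm, dist_eq_norm, ← map_sub]
    simpa using NonUnitalStarAlgHom.norm_apply_le φ (a - b)

/-- The ⋆-homomorphism `f ↦ φ ∘ f` on bounded continuous functions. -/
def bcfMap (X : Type*) [TopologicalSpace X] (φ : B →⋆ₙₐ[ℂ] C) :
    (X →ᵇ B) →⋆ₙₐ[ℂ] (X →ᵇ C) where
  toFun f := f.comp φ (starHom_lipschitz φ)
  map_smul' c f := by ext x; exact map_smul φ c (f x)
  map_zero' := by ext x; exact map_zero φ
  map_add' f g := by ext x; exact map_add φ (f x) (g x)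
  map_mul' f g := by ext x; exact map_mul φ (f x) (g x)
  map_star' f := by ext x; exact map_star φ (f x)

/-- The ⋆-homomorphism `f ↦ φ ∘ f` on continuous functions on the unit interval. -/
def pathMap (φ : B →⋆ₙₐ[ℂ] C) : C(unitInterval, B) →⋆ₙₐ[ℂ] C(unitInterval, C) where
  toFun f := ⟨fun t => φ (f t), (starHom_lipschitz φ).continuous.comp f.continuous⟩
  map_smul' c f := by ext x; exact map_smul φ c (f x)
  map_zero' := by ext x; exact map_zero φ
  map_add' f g := by ext x; exact map_add φ (f x) (g x)
  map_mul' f g := by ext x; exact map_mul φ (f x) (g x)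
  map_star' f := by ext x; exact map_star φ (f x)

/-- The ⋆-homomorphism `f ↦ φ ∘ f` on continuous functions vanishing at infinity. -/
def zeroAtInftyMap (X : Type*) [TopologicalSpace X] (φ : B →⋆ₙₐ[ℂ] C) :
    C₀(X, B) →⋆ₙₐ[ℂ] C₀(X, C) where
  toFun f :=
    { toFun := fun t => φ (f t)
      continuous_toFun := (starHom_lipschitz φ).continuous.comp f.continuous
      zero_at_infty' := by
        have h := ((starHom_lipschitz φ).continuous.tendsto 0).comp f.zero_at_infty'
        rw [map_zero] at h
        exact h }
  map_smul' c f := by ext x; exact map_smul φ c (f x)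
  map_zero' := by ext x; exact map_zero φ
  map_add' f g := by ext x; exact map_add φ (f x) (g x)
  map_mul' f g := by ext x; exact map_mul φ (f x) (g x)
  map_star' f := by ext x; exact map_star φ (f x)

variable {G : Type*} [Group G]

instance pathGraded [GradedGCStarAlgebra G B] : GradedGCStarAlgebra G C(unitInterval, B) where
  act g := pathMap (gact g)
  act_one f := by ext t; exact GradedGCStarAlgebra.act_one (f t)
  act_mul g h f := by ext t; exact GradedGCStarAlgebra.act_mul g h (f t)
  grade := pathMap (gradeAut G)
  grade_grade f := by ext t; exact GradedGCStarAlgebra.grade_grade (G := G) (f t)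
  grade_act g f := by ext t; exact GradedGCStarAlgebra.grade_act g (f t)

instance zeroAtInftyGraded (X : Type*) [TopologicalSpace X] [GradedGCStarAlgebra G B] :
    GradedGCStarAlgebra G C₀(X, B) where
  act g := zeroAtInftyMap X (gact g)
  act_one f := by ext t; exact GradedGCStarAlgebra.act_one (f t)
  act_mul g h f := by ext t; exact GradedGCStarAlgebra.act_mul g h (f t)
  grade := zeroAtInftyMap X (gradeAut G)
  grade_grade f := by ext t; exact GradedGCStarAlgebra.grade_grade (G := G) (f t)
  grade_act g f := by ext t; exact GradedGCStarAlgebra.grade_act g (f t)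

/-- Evaluation `C([0,1]; B) → B` at `t`. -/
def evalPath (G : Type*) [Group G] (B : Type*) [NonUnitalCStarAlgebra B]
    [GradedGCStarAlgebra G B] (t : unitInterval) : GStarHom G C(unitInterval, B) B where
  toHom :=
    { toFun := fun f => f t
      map_smul' := fun _ _ => rfl
      map_zero' := rfl
      map_add' := fun _ _ => rfl
      map_mul' := fun _ _ => rfl
      map_star' := fun _ => rfl }
  map_act _ _ := rfl
  map_grade _ := rfl

end FunctionAlgebras

/-! ### Generalized asymptotic algebras -/

section Asymptotic

variable {X : Type*} [TopologicalSpace X] (l : Filter X)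
variable (B : Type*) [NonUnitalCStarAlgebra B]

/-- `C₀(X; B)`: the bounded continuous functions that converge to zero along the filter `l`. -/
def vanishingAlong : Submodule ℂ (X →ᵇ B) where
  carrier := {f | Tendsto f l (𝓝 0)}
  zero_mem' := tendsto_const_nhds
  add_mem' {f g} hf hg := by
    have h := Tendsto.add hf hg
    rw [add_zero] at h
    exact h
  smul_mem' c f hf := by
    have h := Tendsto.const_smul hf c
    rw [smul_zero] at h
    exact h

instance vanishingAlong_isClosed : IsClosed (vanishingAlong l B : Set (X →ᵇ B)) := by
  refine isClosed_of_closure_subset fun f hf => ?_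
  change Tendsto f l (𝓝 0)
  rw [Metric.tendsto_nhds]
  intro ε hε
  obtain ⟨g, hg, hfg⟩ := Metric.mem_closure_iff.1 hf (ε / 2) (half_pos hε)
  filter_upwards [Metric.tendsto_nhds.1 (show Tendsto g l (𝓝 0) from hg) (ε / 2) (half_pos hε)]
    with x hx
  calc dist (f x) 0 ≤ dist (f x) (g x) + dist (g x) 0 := dist_triangle _ _ _
    _ < ε / 2 + ε / 2 :=
      add_lt_add ((BoundedContinuousFunction.dist_coe_le_dist x).trans_lt hfg) hx
    _ = ε := add_halves ε

/-- The generalized asymptotic algebra `C_b(X; B) / C₀(X; B)` of the space `X` with filter `l`. -/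
def AsympAlg : Type _ := (X →ᵇ B) ⧸ vanishingAlong l B

namespace AsympAlg

instance : NormedAddCommGroup (AsympAlg l B) :=
  inferInstanceAs (NormedAddCommGroup ((X →ᵇ B) ⧸ vanishingAlong l B))

instance : NormedSpace ℂ (AsympAlg l B) :=
  inferInstanceAs (NormedSpace ℂ ((X →ᵇ B) ⧸ vanishingAlong l B))

instance : CompleteSpace (AsympAlg l B) :=
  inferInstanceAs (CompleteSpace ((X →ᵇ B) ⧸ vanishingAlong l B))

variable {B}

/-- The class in `C_b(X; B) / C₀(X; B)` of a bounded continuous function. -/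
def mk (f : X →ᵇ B) : AsympAlg l B := Submodule.Quotient.mk f

variable {l}

theorem mk_surjective (x : AsympAlg l B) : ∃ f, mk l f = x :=
  Submodule.Quotient.mk_surjective _ x

theorem mk_eq_mk {f g : X →ᵇ B} : mk l f = mk l g ↔ Tendsto (fun x => f x - g x) l (𝓝 0) :=
  Submodule.Quotient.eq (vanishingAlong l B)

theorem mk_add (f g : X →ᵇ B) : mk l (f + g) = mk l f + mk l g := rfl
theorem mk_smul (c : ℂ) (f : X →ᵇ B) : mk l (c • f) = c • mk l f := rfl
theorem mk_zero : mk l (0 : X →ᵇ B) = 0 := rfl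

theorem tendsto_bdd_mul (f g : X →ᵇ B) (hg : Tendsto g l (𝓝 0)) :
    Tendsto (fun x => f x * g x) l (𝓝 0) := by
  refine squeeze_zero_norm (a := fun x => ‖f‖ * ‖g x‖) (fun x => ?_) ?_
  · exact (norm_mul_le _ _).trans
      (mul_le_mul_of_nonneg_right (f.norm_coe_le_norm x) (norm_nonneg _))
  · simpa using hg.norm.const_mul ‖f‖

theorem tendsto_mul_bdd (f g : X →ᵇ B) (hg : Tendsto g l (𝓝 0)) :
    Tendsto (fun x => g x * f x) l (𝓝 0) := by
  refine squeeze_zero_norm (a := fun x => ‖g x‖ * ‖f‖) (fun x => ?_) ?_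
  · exact (norm_mul_le _ _).trans
      (mul_le_mul_of_nonneg_left (f.norm_coe_le_norm x) (norm_nonneg _))
  · simpa using hg.norm.mul_const ‖f‖

instance : Mul (AsympAlg l B) where
  mul := Quotient.map₂ (· * ·) fun f f' hf g g' hg => by
    have hf' : Tendsto (f - f') l (𝓝 0) := (Submodule.quotientRel_def _).1 hf
    have hg' : Tendsto (g - g') l (𝓝 0) := (Submodule.quotientRel_def _).1 hg
    refine (Submodule.quotientRel_def _).2 ?_
    change Tendsto (fun x => f x * g x - f' x * g' x) l (𝓝 0)
    have h := (tendsto_bdd_mul f (g - g') hg').add (tendsto_mul_bdd g' (f - f') hf')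
    rw [add_zero] at h
    refine h.congr fun x => ?_
    simp only [BoundedContinuousFunction.coe_sub, Pi.sub_apply]
    noncomm_ring

instance : Star (AsympAlg l B) where
  star := Quotient.map star fun f f' hf => by
    have hf' : Tendsto (f - f') l (𝓝 0) := (Submodule.quotientRel_def _).1 hf
    refine (Submodule.quotientRel_def _).2 ?_
    change Tendsto (fun x => star (f x) - star (f' x)) l (𝓝 0)
    have h := (continuous_star.tendsto (0 : B)).comp hf'
    rw [star_zero] at h
    exact h.congr fun x => by simp

theorem mk_mul (f g : X →ᵇ B) : mk l (f * g) = mk l f * mk l g := rfl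
theorem mk_star (f : X →ᵇ B) : mk l (star f) = star (mk l f) := rfl

theorem eventually_norm_le {f : X →ᵇ B} {c : ℝ} (h : ‖mk l f‖ < c) : ∀ᶠ x in l, ‖f x‖ ≤ c := by
  obtain ⟨g, hg, hgc⟩ := QuotientAddGroup.norm_lt_iff.1 h
  have hgf : mk l f = mk l g := hg.symm
  have ht := Metric.tendsto_nhds.1 (mk_eq_mk.1 hgf) (c - ‖g‖) (sub_pos.2 hgc)
  filter_upwards [ht] with x hx
  rw [dist_zero_right] at hx
  have h1 : ‖f x‖ ≤ ‖f x - g x‖ + ‖g x‖ := norm_le_norm_sub_add _ _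
  have h2 := g.norm_coe_le_norm x
  linarith

theorem norm_mk_le {f : X →ᵇ B} {c : ℝ} (hc : 0 < c) (h : ∀ᶠ x in l, ‖f x‖ ≤ c) :
    ‖mk l f‖ ≤ c := by
  have hpos : ∀ x, 0 < max c ‖f x‖ := fun x => lt_max_of_lt_left hc
  have hcont : Continuous fun x => ((c / max c ‖f x‖ : ℝ) : ℂ) • f x := by
    refine Continuous.smul (Complex.continuous_ofReal.comp ?_) f.continuous
    exact continuous_const.div (continuous_const.max f.continuous.norm) fun x => (hpos x).ne'
  have hb : ∀ x, ‖((c / max c ‖f x‖ : ℝ) : ℂ) • f x‖ ≤ c := by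
    intro x
    rw [norm_smul, Complex.norm_real, Real.norm_of_nonneg (div_nonneg hc.le (hpos x).le),
      div_mul_eq_mul_div, div_le_iff₀ (hpos x)]
    exact mul_le_mul_of_nonneg_left (le_max_right _ _) hc.le
  let g : X →ᵇ B := BoundedContinuousFunction.ofNormedAddCommGroup _ hcont c hb
  have hfg : mk l f = mk l g := by
    rw [mk_eq_mk]
    refine tendsto_const_nhds.congr' ?_
    filter_upwards [h] with x hx
    change 0 = f x - ((c / max c ‖f x‖ : ℝ) : ℂ) • f x
    rw [max_eq_left hx, div_self hc.ne']
    simp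
  rw [hfg]
  exact (Submodule.Quotient.norm_mk_le (S := vanishingAlong l B) g).trans
    (BoundedContinuousFunction.norm_ofNormedAddCommGroup_le _ hc.le _)

/-- The quotient C⋆-algebra structure. -/
instance : NonUnitalCStarAlgebra (AsympAlg l B) where
  __ := (inferInstance : NormedAddCommGroup (AsympAlg l B))
  __ := (inferInstance : NormedSpace ℂ (AsympAlg l B))
  __ := (inferInstance : CompleteSpace (AsympAlg l B))
  left_distrib x y z := by
    obtain ⟨f, rfl⟩ := mk_surjective x
    obtain ⟨g, rfl⟩ := mk_surjective y
    obtain ⟨h, rfl⟩ := mk_surjective z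
    exact congrArg (mk l) (mul_add f g h)
  right_distrib x y z := by
    obtain ⟨f, rfl⟩ := mk_surjective x
    obtain ⟨g, rfl⟩ := mk_surjective y
    obtain ⟨h, rfl⟩ := mk_surjective z
    exact congrArg (mk l) (add_mul f g h)
  zero_mul x := by
    obtain ⟨f, rfl⟩ := mk_surjective x
    exact congrArg (mk l) (zero_mul f)
  mul_zero x := by
    obtain ⟨f, rfl⟩ := mk_surjective x
    exact congrArg (mk l) (mul_zero f)
  mul_assoc x y z := by
    obtain ⟨f, rfl⟩ := mk_surjective x
    obtain ⟨g, rfl⟩ := mk_surjective y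
    obtain ⟨h, rfl⟩ := mk_surjective z
    exact congrArg (mk l) (mul_assoc f g h)
  star_involutive x := by
    obtain ⟨f, rfl⟩ := mk_surjective x
    exact congrArg (mk l) (star_star f)
  star_mul x y := by
    obtain ⟨f, rfl⟩ := mk_surjective x
    obtain ⟨g, rfl⟩ := mk_surjective y
    exact congrArg (mk l) (star_mul f g)
  star_add x y := by
    obtain ⟨f, rfl⟩ := mk_surjective x
    obtain ⟨g, rfl⟩ := mk_surjective y
    exact congrArg (mk l) (star_add f g)
  star_smul c x := by
    obtain ⟨f, rfl⟩ := mk_surjective x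
    exact congrArg (mk l) (star_smul c f)
  smul_assoc c x y := by
    obtain ⟨f, rfl⟩ := mk_surjective x
    obtain ⟨g, rfl⟩ := mk_surjective y
    exact congrArg (mk l) (smul_mul_assoc c f g)
  smul_comm c x y := by
    obtain ⟨f, rfl⟩ := mk_surjective x
    obtain ⟨g, rfl⟩ := mk_surjective y
    exact congrArg (mk l) (mul_smul_comm c f g).symm
  norm_mul_le x y := by
    obtain ⟨f, rfl⟩ := mk_surjective x
    obtain ⟨g, rfl⟩ := mk_surjective y
    have key : ∀ ε : ℝ, 0 < ε →
        ‖mk l f * mk l g‖ ≤ (‖mk l f‖ + ε) * (‖mk l g‖ + ε) := by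
      intro ε hε
      have hf : 0 < ‖mk l f‖ + ε := add_pos_of_nonneg_of_pos (norm_nonneg _) hε
      have hg : 0 < ‖mk l g‖ + ε := add_pos_of_nonneg_of_pos (norm_nonneg _) hε
      refine norm_mk_le (f := f * g) (mul_pos hf hg) ?_
      filter_upwards [eventually_norm_le (lt_add_of_pos_right ‖mk l f‖ hε),
        eventually_norm_le (lt_add_of_pos_right ‖mk l g‖ hε)] with x h1 h2
      exact (norm_mul_le _ _).trans (mul_le_mul h1 h2 (norm_nonneg _) hf.le)
    have hc : Continuous fun ε : ℝ => (‖mk l f‖ + ε) * (‖mk l g‖ + ε) := by fun_prop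
    have ht : Tendsto (fun ε : ℝ => (‖mk l f‖ + ε) * (‖mk l g‖ + ε)) (𝓝[>] 0)
        (𝓝 (‖mk l f‖ * ‖mk l g‖)) := by
      have h0 := (hc.tendsto 0).mono_left (nhdsWithin_le_nhds (s := Set.Ioi 0))
      simpa using h0
    refine ge_of_tendsto ht ?_
    filter_upwards [self_mem_nhdsWithin] with ε hε
    exact key ε hε
  norm_mul_self_le x := by
    obtain ⟨f, rfl⟩ := mk_surjective x
    refine le_of_forall_gt_imp_ge_of_dense fun d hd => ?_
    have hd0 : 0 < d := (norm_nonneg _).trans_lt hd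
    have h1 : ‖mk l f‖ ≤ √d := by
      refine norm_mk_le (Real.sqrt_pos.2 hd0) ?_
      filter_upwards [eventually_norm_le (f := star f * f) hd] with x hx
      refine Real.le_sqrt_of_sq_le ?_
      rw [sq, ← CStarRing.norm_star_mul_self]
      exact hx
    calc ‖mk l f‖ * ‖mk l f‖ ≤ √d * √d := mul_self_le_mul_self (norm_nonneg _) h1
      _ = d := Real.mul_self_sqrt hd0.le

variable (l) in
/-- Functoriality in the coefficients: `[f] ↦ [φ ∘ f]`. -/
def mapHom {C : Type*} [NonUnitalCStarAlgebra C] (φ : B →⋆ₙₐ[ℂ] C) :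
    AsympAlg l B →⋆ₙₐ[ℂ] AsympAlg l C where
  toFun := Quotient.map (bcfMap X φ) fun f f' hf => by
    have hf' : Tendsto (f - f') l (𝓝 0) := (Submodule.quotientRel_def _).1 hf
    refine (Submodule.quotientRel_def _).2 ?_
    change Tendsto (fun x => φ (f x) - φ (f' x)) l (𝓝 0)
    have h := ((starHom_lipschitz φ).continuous.tendsto 0).comp hf'
    rw [map_zero] at h
    exact h.congr fun x => by simp
  map_smul' c x := by
    obtain ⟨f, rfl⟩ := mk_surjective x
    exact congrArg (mk l) (map_smul (bcfMap X φ) c f)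
  map_zero' := congrArg (mk l) (map_zero (bcfMap X φ))
  map_add' x y := by
    obtain ⟨f, rfl⟩ := mk_surjective x
    obtain ⟨g, rfl⟩ := mk_surjective y
    exact congrArg (mk l) (map_add (bcfMap X φ) f g)
  map_mul' x y := by
    obtain ⟨f, rfl⟩ := mk_surjective x
    obtain ⟨g, rfl⟩ := mk_surjective y
    exact congrArg (mk l) (map_mul (bcfMap X φ) f g)
  map_star' x := by
    obtain ⟨f, rfl⟩ := mk_surjective x
    exact congrArg (mk l) (map_star (bcfMap X φ) f)

theorem mapHom_mk {C : Type*} [NonUnitalCStarAlgebra C] (φ : B →⋆ₙₐ[ℂ] C) (f : X →ᵇ B) :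
    mapHom l φ (mk l f) = mk l (bcfMap X φ f) := rfl

/-- The `G`-action and the grading on `C_b(X; B) / C₀(X; B)` come from those of `B`. -/
instance {G : Type*} [Group G] [GradedGCStarAlgebra G B] :
    GradedGCStarAlgebra G (AsympAlg l B) where
  act g := mapHom l (gact g)
  act_one x := by
    obtain ⟨f, rfl⟩ := mk_surjective x
    refine congrArg (mk l) ?_
    ext t
    exact GradedGCStarAlgebra.act_one (f t)
  act_mul g h x := by
    obtain ⟨f, rfl⟩ := mk_surjective x
    refine congrArg (mk l) ?_
    ext t
    exact GradedGCStarAlgebra.act_mul g h (f t)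
  grade := mapHom l (gradeAut G)
  grade_grade x := by
    obtain ⟨f, rfl⟩ := mk_surjective x
    refine congrArg (mk l) ?_
    ext t
    exact GradedGCStarAlgebra.grade_grade (G := G) (f t)
  grade_act g x := by
    obtain ⟨f, rfl⟩ := mk_surjective x
    refine congrArg (mk l) ?_
    ext t
    exact GradedGCStarAlgebra.grade_act g (f t)

variable (l) in
/-- Functoriality in the coefficients for morphisms of graded `G`-C⋆-algebras. -/
def map {G : Type*} [Group G] [GradedGCStarAlgebra G B] {C : Type*} [NonUnitalCStarAlgebra C]
    [GradedGCStarAlgebra G C] (φ : GStarHom G B C) :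
    GStarHom G (AsympAlg l B) (AsympAlg l C) where
  toHom := mapHom l φ.toHom
  map_act g x := by
    obtain ⟨f, rfl⟩ := mk_surjective x
    refine congrArg (mk l) ?_
    ext t
    exact φ.map_act g (f t)
  map_grade x := by
    obtain ⟨f, rfl⟩ := mk_surjective x
    refine congrArg (mk l) ?_
    ext t
    exact φ.map_grade (f t)

/-- Functoriality in the space: a continuous filter-proper map `p : X → Y` induces
`[f] ↦ [f ∘ p]`. -/
def pullback {G : Type*} [Group G] [GradedGCStarAlgebra G B] {Y : Type*} [TopologicalSpace Y]
    {l' : Filter Y} (p : C(X, Y)) (hp : Tendsto p l l') :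
    GStarHom G (AsympAlg l' B) (AsympAlg l B) where
  toHom :=
    { toFun := Quotient.map (fun f : Y →ᵇ B => f.compContinuous p) fun f f' hf => by
        have hf' : Tendsto (f - f') l' (𝓝 0) := (Submodule.quotientRel_def _).1 hf
        exact (Submodule.quotientRel_def _).2 (hf'.comp hp)
      map_smul' := fun c x => by
        obtain ⟨f, rfl⟩ := mk_surjective x
        rfl
      map_zero' := rfl
      map_add' := fun x y => by
        obtain ⟨f, rfl⟩ := mk_surjective x
        obtain ⟨g, rfl⟩ := mk_surjective y
        rfl
      map_mul' := fun x y => by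
        obtain ⟨f, rfl⟩ := mk_surjective x
        obtain ⟨g, rfl⟩ := mk_surjective y
        rfl
      map_star' := fun x => by
        obtain ⟨f, rfl⟩ := mk_surjective x
        rfl }
  map_act g x := by
    obtain ⟨f, rfl⟩ := mk_surjective x
    rfl
  map_grade x := by
    obtain ⟨f, rfl⟩ := mk_surjective x
    rfl

end AsympAlg

end Asymptotic

/-! ### The full simplex on a set, and simpltotic algebras -/

/-- The geometric realization `|Δ^S|` of the full simplicial complex with vertex set `S`: finite
formal convex combinations of elements of `S`. -/
@[ext]
structure FullSimplex (S : Type*) where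
  coeff : S →₀ ℝ
  nonneg : ∀ s, 0 ≤ coeff s
  sum_eq_one : (coeff.sum fun _ r => r) = 1

namespace FullSimplex

/-- The inclusion of the closed simplex with vertices `F`, for a finite set `F` of vertices. -/
def incl {S : Type*} (F : Finset S) (p : stdSimplex ℝ F) : FullSimplex S where
  coeff := ∑ i : F, Finsupp.single (i : S) (p.1 i)
  nonneg s := by
    classical
    rw [Finsupp.finsetSum_apply]
    refine Finset.sum_nonneg fun i _ => ?_
    rw [Finsupp.single_apply]
    split_ifs
    · exact p.2.1 i
    · exact le_rfl
  sum_eq_one := by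
    rw [← Finsupp.sum_finsetSum_index (fun _ => rfl) (fun _ _ _ => rfl)]
    simpa using p.2.2

/-- The weak topology: a set is open if and only if its intersection with each closed simplex
is open in the usual topology of that simplex. -/
instance (S : Type*) : TopologicalSpace (FullSimplex S) :=
  ⨆ F : Finset S, TopologicalSpace.coinduced (incl F) inferInstance

theorem continuous_iff {S Y : Type*} [TopologicalSpace Y] {f : FullSimplex S → Y} :
    Continuous f ↔ ∀ F : Finset S, Continuous fun p => f (incl F p) := by
  rw [continuous_iSup_dom]
  exact forall_congr' fun F => continuous_coinduced_dom

/-- The affine extension `|α| : |Δ^S| → |Δ^T|` of a map `α : S → T`. -/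
def mapFun {S T : Type*} (α : S → T) (x : FullSimplex S) : FullSimplex T where
  coeff := x.coeff.mapDomain α
  nonneg t := by
    classical
    rw [Finsupp.mapDomain, Finsupp.sum_apply]
    refine Finset.sum_nonneg fun s _ => ?_
    simp only [Finsupp.single_apply]
    split_ifs
    · exact x.nonneg s
    · exact le_rfl
  sum_eq_one := by
    rw [Finsupp.sum_mapDomain_index (fun _ => rfl) (fun _ _ _ => rfl)]
    exact x.sum_eq_one

open Classical in
theorem continuous_mapFun {S T : Type*} (α : S → T) : Continuous (mapFun α) := by
  rw [continuous_iff]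
  intro F
  let β : F → (F.image α : Finset T) := fun i => ⟨α i, Finset.mem_image_of_mem α i.2⟩
  have h : (fun p => mapFun α (incl F p)) = fun p => incl (F.image α) (stdSimplex.map β p) := by
    funext p
    refine FullSimplex.ext ?_
    change Finsupp.mapDomain α (∑ i : F, Finsupp.single (i : S) (p.1 i)) =
      ∑ j : (F.image α : Finset T), Finsupp.single (j : T) ((stdSimplex.map β p).1 j)
    rw [Finsupp.mapDomain_finsetSum]
    simp only [Finsupp.mapDomain_single]
    have h2 : ∀ j, (stdSimplex.map β p).1 j = ∑ i with β i = j, p.1 i := by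
      intro j
      change FunOnFinite.linearMap ℝ ℝ β p.1 j = _
      rw [FunOnFinite.linearMap_apply_apply]
    simp only [h2, Finsupp.single_finsetSum]
    rw [← Finset.sum_fiberwise (s := Finset.univ) (g := β)]
    refine Finset.sum_congr rfl fun j _ => Finset.sum_congr rfl fun i hi => ?_
    rw [← (Finset.mem_filter.1 hi).2]
  rw [h]
  have hi : Continuous (incl (F.image α)) :=
    continuous_iff_coinduced_le.2 (le_iSup (fun E : Finset T =>
      TopologicalSpace.coinduced (incl E) inferInstance) (F.image α))
  exact hi.comp (stdSimplex.continuous_map β)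

/-- The affine extension of `α : S → T` as a continuous map. -/
def map {S T : Type*} (α : S → T) : C(FullSimplex S, FullSimplex T) :=
  ⟨mapFun α, continuous_mapFun α⟩

/-- For `m` in a directed set `S`, the face `|Δ^{S ▹ m}|` spanned by the `n ≥ m`. -/
def tail {S : Type*} [Preorder S] (m : S) : Set (FullSimplex S) :=
  {x | ∀ n ∈ x.coeff.support, m ≤ n}

/-- The filter on `|Δ^S|` generated by the faces `|Δ^{S ▹ m}|`. -/
def tailFilter (S : Type*) [Preorder S] : Filter (FullSimplex S) := ⨅ m : S, 𝓟 (tail m)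

/-- The affine extension `x ↦ u_x` of a family `(u_s)` of elements of a complex vector space. -/
def affineExt {S V : Type*} [AddCommGroup V] [Module ℂ V] (u : S → V) (x : FullSimplex S) : V :=
  x.coeff.sum fun s r => (r : ℂ) • u s

end FullSimplex

/-- Nonempty directed sets in the universe `w`. -/
structure DirectedSet : Type (w + 1) where
  carrier : Type w
  [preorder : Preorder carrier]
  [directed : IsDirectedOrder carrier]
  [nonempty : Nonempty carrier]

attribute [instance] DirectedSet.preorder DirectedSet.directed DirectedSet.nonempty

instance : CoeSort DirectedSet.{w} (Type w) := ⟨DirectedSet.carrier⟩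

/-- Cofinal maps between directed sets: the image of a tail eventually lies in any given tail. -/
def IsCofinalMap {m n : DirectedSet.{w}} (α : m → n) : Prop :=
  ∀ i : n, ∃ j : m, ∀ k : m, j ≤ k → i ≤ α k

theorem IsCofinalMap.tendsto {m n : DirectedSet.{w}} {α : m → n} (hα : IsCofinalMap α) :
    Tendsto (FullSimplex.map α) (FullSimplex.tailFilter m) (FullSimplex.tailFilter n) := by
  refine tendsto_iInf.2 fun i => tendsto_principal.2 ?_
  obtain ⟨j, hj⟩ := hα i
  refine mem_of_superset (mem_iInf_of_mem j (mem_principal_self _)) fun x hx => ?_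
  intro t ht
  classical
  obtain ⟨s, hs, rfl⟩ := Finset.mem_image.1 (Finsupp.mapDomain_support ht)
  exact hj s (hx s hs)

/-- The simpltotic algebra `𝔖^m B = C_b(|Δ^m|; B) / C₀(|Δ^m|; B)`. -/
abbrev SimplAlg (m : DirectedSet.{w}) (B : Type*) [NonUnitalCStarAlgebra B] : Type _ :=
  AsympAlg (FullSimplex.tailFilter m) B

/-! ### Homotopy classes and simpltotic morphism sets -/

section Morphisms

variable (G : Type*) [Group G] (A B : Type*) [NonUnitalCStarAlgebra A] [GradedGCStarAlgebra G A]
  [NonUnitalCStarAlgebra B] [GradedGCStarAlgebra G B]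

variable {G A B} in
/-- Two morphisms `A → 𝔖^m B` are `m`-homotopic if they are the evaluations at `0` and `1` of a
morphism `A → 𝔖^m C([0,1]; B)`. -/
def SimplHomotopic {m : DirectedSet.{w}} (φ₀ φ₁ : GStarHom G A (SimplAlg m B)) : Prop :=
  ∃ Φ : GStarHom G A (SimplAlg m C(unitInterval, B)),
    (AsympAlg.map (FullSimplex.tailFilter m) (evalPath G B 0)).comp Φ = φ₀ ∧
    (AsympAlg.map (FullSimplex.tailFilter m) (evalPath G B 1)).comp Φ = φ₁

/-- The set `⟦A, B⟧_m` of `m`-homotopy classes of morphisms `A → 𝔖^m B`. -/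
def SimplMorAt (m : DirectedSet.{w}) : Type _ :=
  Quot (SimplHomotopic : GStarHom G A (SimplAlg m B) → GStarHom G A (SimplAlg m B) → Prop)

variable {G A B} in
/-- The ⋆-homomorphism `α^* : 𝔖^n B → 𝔖^m B` induced by a cofinal map `α : m → n`. -/
def cofinalPullback {m n : DirectedSet.{w}} (α : m → n) (hα : IsCofinalMap α) :
    GStarHom G (SimplAlg n B) (SimplAlg m B) :=
  AsympAlg.pullback (FullSimplex.map α) hα.tendsto

variable {G A B} in
theorem cofinalPullback_natural {m n : DirectedSet.{w}} (α : m → n) (hα : IsCofinalMap α)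
    {C : Type*} [NonUnitalCStarAlgebra C] [GradedGCStarAlgebra G C] (θ : GStarHom G C B)
    (Φ : GStarHom G A (SimplAlg n C)) :
    (AsympAlg.map (FullSimplex.tailFilter m) θ).comp ((cofinalPullback α hα).comp Φ) =
      (cofinalPullback α hα).comp ((AsympAlg.map (FullSimplex.tailFilter n) θ).comp Φ) := by
  refine GStarHom.ext (NonUnitalStarAlgHom.ext fun a => ?_)
  change (AsympAlg.map (FullSimplex.tailFilter m) θ).toHom
      ((cofinalPullback (G := G) (B := C) α hα).toHom (Φ.toHom a)) =
    (cofinalPullback (G := G) (B := B) α hα).toHom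
      ((AsympAlg.map (FullSimplex.tailFilter n) θ).toHom (Φ.toHom a))
  obtain ⟨f, hf⟩ := AsympAlg.mk_surjective (Φ.toHom a)
  rw [← hf]
  rfl

variable {G A B} in
/-- The map `α^* : ⟦A, B⟧_n → ⟦A, B⟧_m` induced by a cofinal map `α : m → n`. -/
def SimplMorAt.pullback {m n : DirectedSet.{w}} (α : m → n) (hα : IsCofinalMap α) :
    SimplMorAt G A B n → SimplMorAt G A B m :=
  Quot.map (fun φ : GStarHom G A (SimplAlg n B) => (cofinalPullback α hα).comp φ) fun φ₀ φ₁ ⟨Φ, h₀, h₁⟩ => by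
    refine ⟨(cofinalPullback (G := G) (B := C(unitInterval, B)) α hα).comp Φ, ?_, ?_⟩
    · rw [← h₀]
      exact (cofinalPullback_natural α hα (evalPath G B 0) Φ)
    · rw [← h₁]
      exact (cofinalPullback_natural α hα (evalPath G B 1) Φ)

/-- The simpltotic morphism set `⟦A, B⟧`: the direct limit of the sets `⟦A, B⟧_m` over all directed
sets `m` and the maps induced by cofinal maps, i.e. the quotient of the disjoint union by the
equivalence relation generated by `x ∼ α^* x`. -/
def SimplMor : Type _ :=
  Quot fun x y : (Σ m : DirectedSet.{w}, SimplMorAt G A B m) =>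
    ∃ (α : y.1 → x.1) (hα : IsCofinalMap α), y.2 = SimplMorAt.pullback α hα x.2

variable {G A B} in
/-- The class `⟦φ⟧` in `⟦A, B⟧` of a morphism `φ : A → 𝔖^m B`. -/
def SimplMor.mk {m : DirectedSet.{w}} (φ : GStarHom G A (SimplAlg m B)) : SimplMor.{w} G A B :=
  Quot.mk _ ⟨m, Quot.mk _ φ⟩

end Morphisms

/-! ### Suspensions, quasicentral approximate units and the extension morphism -/

/-- The suspension `ΣA = C₀((0,1)) ⊗ A = C₀((0,1); A)`. -/
abbrev Susp (A : Type*) [NonUnitalCStarAlgebra A] : Type _ := C₀(Set.Ioo (0 : ℝ) 1, A)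

/-- The elementary tensor `f ⊗ a`, i.e. the function `t ↦ f(t) a`. -/
def elemTensor {A : Type*} [NonUnitalCStarAlgebra A] (f : C₀(Set.Ioo (0 : ℝ) 1, ℂ)) (a : A) :
    Susp A where
  toFun t := f t • a
  continuous_toFun := f.continuous.smul continuous_const
  zero_at_infty' := by
    have h := f.zero_at_infty'.smul_const a
    rw [zero_smul] at h
    exact h

/-- The element `f(b)` obtained by functional calculus from `f ∈ C₀((0,1))`, extended by zero, and
an element `0 ≤ b ≤ 1`. -/
def intervalCalc {B : Type*} [NonUnitalCStarAlgebra B] (f : C₀(Set.Ioo (0 : ℝ) 1, ℂ)) (b : B) : B :=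
  cfcₙ (fun z : ℂ => Function.extend ((↑) : Set.Ioo (0 : ℝ) 1 → ℝ) f 0 z.re) b

/-- `u` is a quasicentral approximate unit in the graded `G`-C⋆-algebra `B` for its subalgebra
`J₀`. -/
structure IsQuasicentralApproxUnit (G : Type*) [Group G] {B : Type*} [NonUnitalCStarAlgebra B]
    [PartialOrder B] [GradedGCStarAlgebra G B] (J₀ : NonUnitalStarSubalgebra ℂ B)
    {m : DirectedSet.{w}} (u : m → B) : Prop where
  mem : ∀ i, u i ∈ J₀
  nonneg : ∀ i, 0 ≤ u i
  norm_le_one : ∀ i, ‖u i‖ ≤ 1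
  tendsto_mul : ∀ j ∈ J₀, Tendsto (fun i => ‖u i * j - j‖) atTop (𝓝 0)
  tendsto_commutator : ∀ b : B, Tendsto (fun i => ‖u i * b - b * u i‖) atTop (𝓝 0)
  tendsto_act : ∀ g : G, Tendsto (fun i => ‖gact g (u i) - u i‖) atTop (𝓝 0)
  tendsto_grade : Tendsto (fun i => ‖gradeAut G (u i) - u i‖) atTop (𝓝 0)

/-- `σ : ΣA → 𝔖^m J` maps `f ⊗ π(b)` to the class of the bounded continuous `J`-valued function
`x ↦ f(u_x) b`; here `ι : J → B` is the inclusion. -/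
def IsExtensionMorphism {G : Type*} [Group G] {J B A : Type*}
    [NonUnitalCStarAlgebra J] [GradedGCStarAlgebra G J]
    [NonUnitalCStarAlgebra B] [GradedGCStarAlgebra G B]
    [NonUnitalCStarAlgebra A] [GradedGCStarAlgebra G A]
    (ι : GStarHom G J B) (π : GStarHom G B A) {m : DirectedSet.{w}} (u : m → B)
    (σ : GStarHom G (Susp A) (SimplAlg m J)) : Prop :=
  ∀ (f : C₀(Set.Ioo (0 : ℝ) 1, ℂ)) (b : B), ∃ F : FullSimplex m →ᵇ J,
    (∀ x, ι.toHom (F x) = intervalCalc f (FullSimplex.affineExt u x) * b) ∧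
    σ.toHom (elemTensor f (π.toHom b)) = AsympAlg.mk _ F

end

noncomputable section

/-! ### Partitions of unity and density of elementary tensors -/

/-! The morphism `σ` is the product of two commuting homomorphisms into the asymptotic algebra of
`B`. One is functional calculus `f ↦ f(h)` at the class `h` of `x ↦ u_x`, the other sends `b` to the
constant function `b`. They commute because `u` is quasicentral. Since `h` acts as a unit on `J =
ker π`, the identity `f = g - g · id` with `g = f / (1 - id)` shows that `f(h) b = 0` for `b ∈ J`
and `f` of compact support (`intervalCalc_mul_eq_zero`). Hence `f(h) b` depends on `b` only through
`π(b)`, up to a limit in `f`.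

What remains is boundedness of `∑ f ⊗ π(b) ↦ ∑ f(h) b`. It is proved without tensor product theory,
by the direct estimate `norm_productMap_le`. A partition of unity replaces the sum by `∑ᵢ |χᵢ|²(h)
bᵢ`. The vanishing just described allows each `bᵢ` to be exchanged for a combination of positive
lifts of controlled norm, and a sum of conjugates of bounded positive elements is bounded. Density
of the elementary tensors gives the homomorphism (`exists_product_starHom`). It takes values in the
asymptotic algebra of `J`, which embeds isometrically into that of `B`; this yields
`exists_extension_morphism`.

For independence, both nets are pulled back to the product of their index sets. The straight path
between them consists of approximate units uniformly in the path parameter, so the same construction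
with coefficients `C([0,1]; J)` gives a homotopy (`exists_extension_homotopy`). Its endpoints are
recognized because elementary tensors determine a morphism. The constant path settles existence in
the first assertion, so one construction serves both. -/

theorem zeroAtInfty_sum_apply {X E ι : Type*} [TopologicalSpace X] [NormedAddCommGroup E]
    (s : Finset ι) (F : ι → C₀(X, E)) (x : X) : (∑ i ∈ s, F i) x = ∑ i ∈ s, F i x :=
  map_sum (⟨⟨fun f : C₀(X, E) => f x, rfl⟩, fun _ _ => rfl⟩ : C₀(X, E) →+ E) F s

/-- A function `F` vanishing at infinity is uniformly approximated by finite sums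
`∑ᵢ |χᵢ|² ⊗ F(xᵢ)` with compactly supported `χᵢ` such that `∑ᵢ |χᵢ|² ≤ 1`. -/
theorem exists_partition_approx {X E : Type*} [TopologicalSpace X] [T2Space X]
    [LocallyCompactSpace X] [NormedAddCommGroup E] [NormedSpace ℂ E] (F : C₀(X, E))
    {ε : ℝ} (hε : 0 < ε) :
    ∃ (s : Finset X) (χ : s → C₀(X, ℂ)), (∀ i, HasCompactSupport (χ i)) ∧
      ‖∑ i, star (χ i) * χ i‖ ≤ 1 ∧
      ∀ x, ‖F x - ∑ i, (star (χ i) * χ i) x • F i‖ ≤ ε := by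
  obtain ⟨K, hK, hKF⟩ : ∃ K : Set X, IsCompact K ∧ ∀ x ∉ K, ‖F x‖ < ε / 2 := by
    have h := Metric.tendsto_nhds.1 F.zero_at_infty' (ε / 2) (half_pos hε)
    obtain ⟨K, hK, hKF⟩ := mem_cocompact.1 h
    exact ⟨K, hK, fun x hx => by simpa using hKF hx⟩
  let U : X → Set X := fun y => {x | ‖F x - F y‖ < ε / 2}
  have hU : ∀ y, IsOpen (U y) := fun y =>
    isOpen_lt (F.continuous.sub continuous_const).norm continuous_const
  obtain ⟨s, hs⟩ := hK.elim_finite_subcover U hU fun x _ =>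
    Set.mem_iUnion.2 ⟨x, by simpa [U] using half_pos hε⟩
  have hs' : K ⊆ ⋃ i : s, U i := fun x hx => by
    obtain ⟨i, hi, hxi⟩ := Set.mem_iUnion₂.1 (hs hx)
    exact Set.mem_iUnion.2 ⟨⟨i, hi⟩, hxi⟩
  obtain ⟨f, hfU, hfc⟩ := PartitionOfUnity.exists_isSubordinate_of_locallyFinite_t2space hK
    (fun i : s => U i) (fun i => hU i) (locallyFinite_of_finite _) hs'
  have hsum : ∀ x, ∑ᶠ i, f i x = ∑ i, f i x := fun x => finsum_eq_sum_of_fintype _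
  have hcs : ∀ i, HasCompactSupport fun x => ((√(f i x) : ℝ) : ℂ) := fun i =>
    (hfc i).comp_left (g := fun r : ℝ => ((√r : ℝ) : ℂ)) (by simp)
  -- Square roots of the partition functions: a weight of the form `star χ * χ` can later be placed
  -- on both sides of a positive element.
  let χ : s → C₀(X, ℂ) := fun i =>
    { toFun := fun x => ((√(f i x) : ℝ) : ℂ)
      continuous_toFun := Complex.continuous_ofReal.comp (f i).continuous.sqrt
      zero_at_infty' := (hcs i).is_zero_at_infty }
  have hχ : ∀ i x, (star (χ i) * χ i) x = ((f i x : ℝ) : ℂ) := fun i x => by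
    change star ((√(f i x) : ℝ) : ℂ) * ((√(f i x) : ℝ) : ℂ) = _
    rw [Complex.star_def, Complex.conj_ofReal, ← Complex.ofReal_mul,
      Real.mul_self_sqrt (f.nonneg i x)]
  refine ⟨s, χ, hcs, ?_, fun x => ?_⟩
  · rw [← ZeroAtInftyContinuousMap.norm_toBCF_eq_norm,
      BoundedContinuousFunction.norm_le zero_le_one]
    intro x
    have h : (∑ i, star (χ i) * χ i).toBCF x = ((∑ i, f i x : ℝ) : ℂ) := by
      change (∑ i, star (χ i) * χ i) x = _
      rw [zeroAtInfty_sum_apply, Complex.ofReal_sum]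
      exact Finset.sum_congr rfl fun i _ => hχ i x
    rw [h, Complex.norm_real, Real.norm_of_nonneg (Finset.sum_nonneg fun i _ => f.nonneg i x),
      ← hsum]
    exact f.sum_le_one x
  · have hle : ∀ i, ‖((f i x : ℝ) : ℂ) • (F x - F i)‖ ≤ f i x * (ε / 2) := fun i => by
      rw [norm_smul, Complex.norm_real, Real.norm_of_nonneg (f.nonneg i x)]
      by_cases hx : f i x = 0
      · simp [hx]
      · exact mul_le_mul_of_nonneg_left
          (hfU i (subset_closure (Function.mem_support.2 hx))).le (f.nonneg i x)
    have h1 : ‖∑ i, ((f i x : ℝ) : ℂ) • (F x - F i)‖ ≤ ε / 2 := by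
      refine (norm_sum_le _ _).trans ((Finset.sum_le_sum fun i _ => hle i).trans ?_)
      rw [← Finset.sum_mul, ← hsum]
      exact mul_le_of_le_one_left (half_pos hε).le (f.sum_le_one x)
    -- The partition sums to one only on `K`. The defect term vanishes there, and off `K` the
    -- function `F` is itself small.
    have h2 : F x - ∑ i, (star (χ i) * χ i) x • F i =
        (1 - ((∑ i, f i x : ℝ) : ℂ)) • F x + ∑ i, ((f i x : ℝ) : ℂ) • (F x - F i) := by
      simp only [hχ, smul_sub, Finset.sum_sub_distrib, ← Finset.sum_smul, Complex.ofReal_sum,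
        sub_smul, one_smul]
      abel
    rw [h2]
    refine (norm_add_le _ _).trans ?_
    have h3 : ‖(1 - ((∑ i, f i x : ℝ) : ℂ)) • F x‖ ≤ ε / 2 := by
      rw [norm_smul, ← Complex.ofReal_one, ← Complex.ofReal_sub, Complex.norm_real, ← hsum,
        Real.norm_of_nonneg (sub_nonneg.2 (f.sum_le_one x))]
      by_cases hx : x ∈ K
      · rw [f.sum_eq_one hx, sub_self, zero_mul]
        exact (half_pos hε).le
      · exact (mul_le_of_le_one_left (norm_nonneg _)
          (by linarith [f.sum_nonneg x])).trans (hKF x hx).le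
    linarith

/-- The elementary tensor `f ⊗ a` in `C₀(X; A)`. -/
def zeroAtInftyTensor {X A : Type*} [TopologicalSpace X] [NonUnitalCStarAlgebra A]
    (f : C₀(X, ℂ)) (a : A) : C₀(X, A) where
  toFun t := f t • a
  continuous_toFun := f.continuous.smul continuous_const
  zero_at_infty' := by
    have h := f.zero_at_infty'.smul_const a
    rw [zero_smul] at h
    exact h

theorem zeroAtInfty_norm_le {X E : Type*} [TopologicalSpace X] [NormedAddCommGroup E]
    {F : C₀(X, E)} {c : ℝ} (hc : 0 ≤ c) : ‖F‖ ≤ c ↔ ∀ x, ‖F x‖ ≤ c := by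
  rw [← ZeroAtInftyContinuousMap.norm_toBCF_eq_norm, BoundedContinuousFunction.norm_le hc]
  rfl

theorem zeroAtInfty_norm_apply_le {X E : Type*} [TopologicalSpace X] [NormedAddCommGroup E]
    (F : C₀(X, E)) (x : X) : ‖F x‖ ≤ ‖F‖ :=
  (zeroAtInfty_norm_le (norm_nonneg F)).1 le_rfl x

/-! ### Products of commuting homomorphisms on `C₀(X)` and `B` -/

section CoreTensor

variable {X : Type*} [TopologicalSpace X] {A B D : Type*} [NonUnitalCStarAlgebra A]
  [NonUnitalCStarAlgebra B] [NonUnitalCStarAlgebra D]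

/-- The linear span of the elementary tensors, as the range of a map from a free module. -/
def tensorMap (X : Type*) [TopologicalSpace X] (π : B →⋆ₙₐ[ℂ] A) :
    (C₀(X, ℂ) × B →₀ ℂ) →ₗ[ℂ] C₀(X, A) :=
  Finsupp.linearCombination ℂ fun p => zeroAtInftyTensor p.1 (π p.2)

theorem tensorMap_single (π : B →⋆ₙₐ[ℂ] A) (f : C₀(X, ℂ)) (b : B) :
    tensorMap X π (Finsupp.single (f, b) 1) = zeroAtInftyTensor f (π b) := by
  simp [tensorMap]

/-- The approximating sums of `exists_partition_approx` have the values of `F` at finitely many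
points as coefficients, and each of these lifts through `π`. -/
theorem denseRange_tensorMap [T2Space X] [LocallyCompactSpace X] (π : B →⋆ₙₐ[ℂ] A)
    (hπ : Function.Surjective π) : DenseRange (tensorMap X π) := by
  intro F
  rw [Metric.mem_closure_iff]
  intro ε hε
  obtain ⟨s, χ, -, -, h⟩ := exists_partition_approx F (half_pos hε)
  choose b hb using fun i : s => hπ (F i)
  refine ⟨tensorMap X π (∑ i, Finsupp.single (star (χ i) * χ i, b i) 1), ⟨_, rfl⟩, ?_⟩
  refine lt_of_le_of_lt ?_ (half_lt_self hε)
  rw [dist_eq_norm, zeroAtInfty_norm_le (half_pos hε).le]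
  intro x
  refine le_of_eq_of_le (congrArg norm ?_) (h x)
  simp only [map_sum, tensorMap_single, ZeroAtInftyContinuousMap.sub_apply,
    zeroAtInfty_sum_apply, hb]
  rfl

/-- Closed subspaces of `C₀(X; A)` containing all elementary tensors are everything. -/
theorem zeroAtInfty_induction [T2Space X] [LocallyCompactSpace X] {π : B →⋆ₙₐ[ℂ] A}
    (hπ : Function.Surjective π) (S : Submodule ℂ C₀(X, A)) (hS : IsClosed (S : Set C₀(X, A)))
    (h : ∀ f b, zeroAtInftyTensor f (π b) ∈ S) (F : C₀(X, A)) : F ∈ S := by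
  refine hS.closure_subset_iff.2 ?_ (denseRange_tensorMap (X := X) π hπ F)
  rintro _ ⟨z, rfl⟩
  induction z using Finsupp.induction_linear with
  | zero => simp
  | add z w hz hw => rw [map_add]; exact S.add_mem hz hw
  | single p c =>
    simp only [tensorMap, Finsupp.linearCombination_single]
    exact S.smul_mem c (h p.1 p.2)

/-- Conjugates of uniformly bounded positive elements sum up to a bounded element. -/
theorem norm_sum_conjugate_le [PartialOrder D] [StarOrderedRing D] {ι : Type*} (s : Finset ι)
    (p r : ι → D) {M : ℝ} (hr : ∀ i, 0 ≤ r i) (hM : ∀ i, ‖r i‖ ≤ M) :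
    ‖∑ i ∈ s, star (p i) * r i * p i‖ ≤ M * ‖∑ i ∈ s, star (p i) * p i‖ := by
  rcases s.eq_empty_or_nonempty with rfl | ⟨i₀, -⟩
  · simp
  have hM0 : 0 ≤ M := (norm_nonneg _).trans (hM i₀)
  calc ‖∑ i ∈ s, star (p i) * r i * p i‖ ≤ ‖M • ∑ i ∈ s, star (p i) * p i‖ := by
        refine CStarAlgebra.norm_le_norm_of_nonneg_of_le
          (Finset.sum_nonneg fun i _ => star_left_conjugate_nonneg (hr i) _) ?_
        rw [Finset.smul_sum]
        refine Finset.sum_le_sum fun i _ => ?_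
        exact (CStarAlgebra.star_left_conjugate_le_norm_smul (.of_nonneg (hr i))).trans
          (smul_le_smul_of_nonneg_right (hM i) (star_mul_self_nonneg _))
    _ = M * ‖∑ i ∈ s, star (p i) * p i‖ := by rw [norm_smul, Real.norm_of_nonneg hM0]

/-- Positive elements lift along surjections without increasing the norm. -/
theorem exists_nonneg_lift [PartialOrder A] [StarOrderedRing A] [PartialOrder B]
    [StarOrderedRing B] (π : B →⋆ₙₐ[ℂ] A) (hπ : Function.Surjective π) (a : A) (ha : 0 ≤ a) :
    ∃ b : B, 0 ≤ b ∧ ‖b‖ ≤ ‖a‖ ∧ π b = a := by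
  obtain ⟨b', hb'⟩ := hπ a
  have hasa : IsSelfAdjoint a := .of_nonneg ha
  obtain ⟨b, hb, hba⟩ : ∃ b : B, IsSelfAdjoint b ∧ π b = a := by
    refine ⟨(2⁻¹ : ℂ) • (b' + star b'), ?_, ?_⟩
    · rw [isSelfAdjoint_iff, star_smul, star_add, star_star, add_comm]
      simp
    · rw [map_smul, map_add, map_star, hb', hasa.star_eq, ← two_smul ℂ a, smul_smul]
      norm_num
  -- This truncation forces positivity and the norm bound on the lift, yet is the identity on the
  -- quasispectrum of `a`, so applying it does not change the image under `π`.
  let c : ℝ → ℝ := fun t => min (max t 0) ‖a‖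
  have hc : Continuous c := by fun_prop
  have hc0 : c 0 = 0 := by simp [c]
  have hcn : ∀ t, 0 ≤ c t := fun t => le_min (le_max_right _ _) (norm_nonneg _)
  refine ⟨cfcₙ c b, cfcₙ_nonneg fun t _ => hcn t, norm_cfcₙ_le fun t _ => ?_, ?_⟩
  · rw [Real.norm_of_nonneg (hcn t)]
    exact min_le_right _ _
  · have hq : IsSelfAdjoint (π b) := hba.symm ▸ hasa
    rw [NonUnitalStarAlgHomClass.map_cfcₙ (S := ℂ) π c b hc.continuousOn hc0
      (starHom_lipschitz π).continuous hb hq, hba]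
    conv_rhs => rw [← cfcₙ_id' ℝ a]
    refine cfcₙ_congr fun t ht => ?_
    have h0 : 0 ≤ t := quasispectrum_nonneg_of_nonneg a ha t ht
    have h1 : t ≤ ‖a‖ := (le_abs_self t).trans 
      (NonUnitalIsometricContinuousFunctionalCalculus.norm_quasispectrum_le a ht)
    simp [c, h0, h1]

variable [T2Space X] [LocallyCompactSpace X] (α : C₀(X, ℂ) →⋆ₙₐ[ℂ] D) (β : B →⋆ₙₐ[ℂ] D)
  (π : B →⋆ₙₐ[ℂ] A)

/-- The linear map `∑ f ⊗ b ↦ ∑ α(f) β(b)` on formal sums of elementary tensors. -/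
def productMap : (C₀(X, ℂ) × B →₀ ℂ) →ₗ[ℂ] D :=
  Finsupp.linearCombination ℂ fun p => α p.1 * β p.2

/-- The constant counts the positive parts in the decomposition `a = a₀ + i a₁ - a₂ - i a₃`; any
constant would do for extending by continuity. A given lift `b` of `π(b)` has no useful norm bound,
so `hker` is needed to exchange it for lifts that have one. -/
theorem norm_productMap_le (hπ : Function.Surjective π) (hcomm : ∀ f b, Commute (α f) (β b))
    (hker : ∀ (f : C₀(X, ℂ)) b, HasCompactSupport f → π b = 0 → α f * β b = 0) (z : C₀(X, ℂ) × B →₀ ℂ) :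
    ‖productMap α β z‖ ≤ 4 * ‖tensorMap X π z‖ := by
  let _ := CStarAlgebra.spectralOrder A
  let _ := CStarAlgebra.spectralOrderedRing A
  let _ := CStarAlgebra.spectralOrder B
  let _ := CStarAlgebra.spectralOrderedRing B
  let _ := CStarAlgebra.spectralOrder D
  let _ := CStarAlgebra.spectralOrderedRing D
  refine le_of_forall_pos_le_add fun δ hδ => ?_
  -- Total weight of the `B`-components, which converts a uniform error `ε` in the scalar functions
  -- into an error `ε * C` in `D`.
  set C : ℝ := ∑ p ∈ z.support, ‖z p‖ * ‖p.2‖ with hC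
  have hC0 : 0 ≤ C := Finset.sum_nonneg fun p _ => by positivity
  have hC1 : 0 < C + 1 := by linarith
  obtain ⟨ε, hε, hεC⟩ : ∃ ε : ℝ, 0 < ε ∧ ε * C ≤ δ :=
    ⟨δ / (C + 1), by positivity, by
      rw [div_mul_eq_mul_div, div_le_iff₀ hC1]
      nlinarith⟩
  -- Bundling all scalar functions of `z` into one vector-valued function makes a single partition
  -- work for all of them.
  let F : C₀(X, z.support → ℂ) :=
    { toFun := fun x p => p.1.1 x
      continuous_toFun := continuous_pi fun p => p.1.1.continuous
      zero_at_infty' := tendsto_pi_nhds.2 fun p => p.1.1.zero_at_infty' }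
  obtain ⟨s, χ, hχc, hχ1, hχF⟩ := exists_partition_approx F hε
  have happrox : ∀ p ∈ z.support,
      ‖α p.1 - ∑ i : s, p.1 (i : X) • α (star (χ i) * χ i)‖ ≤ ε := by
    intro p hp
    have h1 : α p.1 - ∑ i : s, p.1 (i : X) • α (star (χ i) * χ i) =
        α (p.1 - ∑ i : s, p.1 (i : X) • (star (χ i) * χ i)) := by
      simp only [map_sub, map_sum, map_smul]
    rw [h1]
    refine (NonUnitalStarAlgHom.norm_apply_le α _).trans ((zeroAtInfty_norm_le hε.le).2 fun x => ?_)
    have h2 := (norm_le_pi_norm _ (⟨p, hp⟩ : z.support)).trans (hχF x)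
    refine le_of_eq_of_le (congrArg norm ?_) h2
    rw [ZeroAtInftyContinuousMap.sub_apply, zeroAtInfty_sum_apply, Pi.sub_apply, Finset.sum_apply]
    refine congrArg₂ _ rfl (Finset.sum_congr rfl fun i _ => ?_)
    simp only [ZeroAtInftyContinuousMap.smul_apply, Pi.smul_apply, smul_eq_mul]
    exact mul_comm _ _
  -- Each scalar function `f` is replaced by `∑ᵢ f(xᵢ) |χᵢ|²`, and the terms are collected at the
  -- points `xᵢ`. The resulting argument of `β` is a lift of the value at `xᵢ` of the tensor sum.
  set y : D := ∑ i : s, α (star (χ i) * χ i) * β (∑ p ∈ z.support, (z p * p.1 (i : X)) • p.2) with hy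
  have hdiff : productMap α β z - y =
      ∑ p ∈ z.support, z p • ((α p.1 - ∑ i : s, p.1 (i : X) • α (star (χ i) * χ i)) * β p.2) := by
    rw [hy, productMap, Finsupp.linearCombination_apply, Finsupp.sum]
    simp only [map_sum, map_smul, Finset.mul_sum, sub_mul, smul_sub, Finset.sum_mul,
      Finset.sum_sub_distrib, Finset.smul_sum]
    congr 1
    rw [Finset.sum_comm]
    refine Finset.sum_congr rfl fun p _ => Finset.sum_congr rfl fun i _ => ?_
    rw [mul_smul_comm, smul_mul_assoc, smul_smul]
  have hdiff_le : ‖productMap α β z - y‖ ≤ δ := by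
    rw [hdiff]
    refine (norm_sum_le _ _).trans (le_trans ?_ hεC)
    rw [hC, Finset.mul_sum]
    refine Finset.sum_le_sum fun p hp => ?_
    rw [norm_smul, mul_left_comm]
    exact mul_le_mul_of_nonneg_left ((norm_mul_le _ _).trans (mul_le_mul (happrox p hp)
      (NonUnitalStarAlgHom.norm_apply_le β _) (norm_nonneg _) hε.le)) (norm_nonneg _)
  have hy_le : ‖y‖ ≤ 4 * ‖tensorMap X π z‖ := by
    set M := ‖tensorMap X π z‖
    choose a ha0 haM ha using fun i : s =>
      CStarAlgebra.exists_sum_four_nonneg (tensorMap X π z (i : X))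
    choose b hb0 hbM hb using fun (i : s) (k : Fin 4) =>
      exists_nonneg_lift π hπ (a i k) (ha0 i k)
    have hβ0 : ∀ i k, 0 ≤ β (b i k) := fun i k => map_nonneg β (hb0 i k)
    have hβM : ∀ i k, ‖β (b i k)‖ ≤ M := fun i k =>
      (NonUnitalStarAlgHom.norm_apply_le β _).trans <| (hbM i k).trans <|
        (haM i k).trans (zeroAtInfty_norm_apply_le _ _)
    have hyi : ∀ i, α (star (χ i) * χ i) * β (∑ p ∈ z.support, (z p * p.1 (i : X)) • p.2) =
        ∑ k : Fin 4, Complex.I ^ (k : ℕ) • (star (α (χ i)) * β (b i k) * α (χ i)) := by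
      intro i
      -- The uncontrolled lift and the combination of positive lifts have the same image under `π`,
      -- and the weight has compact support, so `hker` identifies them.
      have hsub : α (star (χ i) * χ i) * β ((∑ p ∈ z.support, (z p * p.1 (i : X)) • p.2) -
          ∑ k : Fin 4, Complex.I ^ (k : ℕ) • b i k) = 0 := by
        refine hker _ _ ((hχc i).mul_left) ?_
        rw [map_sub, sub_eq_zero, map_sum, map_sum]
        simp only [map_smul, hb]
        rw [← ha i, tensorMap, Finsupp.linearCombination_apply, Finsupp.sum,
          zeroAtInfty_sum_apply]
        refine Finset.sum_congr rfl fun p _ => ?_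
        rw [← smul_smul]
        rfl
      rw [map_sub, mul_sub, sub_eq_zero] at hsub
      rw [hsub, map_sum, Finset.mul_sum]
      refine Finset.sum_congr rfl fun k _ => ?_
      rw [map_smul, mul_smul_comm, map_mul, map_star, mul_assoc, mul_assoc,
        (hcomm (χ i) (b i k)).eq]
    have hyk : y = ∑ k : Fin 4, Complex.I ^ (k : ℕ) •
        ∑ i, star (α (χ i)) * β (b i k) * α (χ i) := by
      rw [hy, Finset.sum_congr rfl fun i _ => hyi i, Finset.sum_comm]
      simp only [Finset.smul_sum]
    -- The partition weights sum to at most one, and `α` is contractive; this keeps the bound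
    -- independent of the number of points.
    have hone : ‖∑ i, star (α (χ i)) * α (χ i)‖ ≤ 1 := by
      have h : ∑ i, star (α (χ i)) * α (χ i) = α (∑ i, star (χ i) * χ i) := by
        simp only [map_sum, map_mul, map_star]
      rw [h]
      exact (NonUnitalStarAlgHom.norm_apply_le α _).trans hχ1
    rw [hyk]
    refine (norm_sum_le _ _).trans ?_
    have hk : ∀ k : Fin 4, ‖Complex.I ^ (k : ℕ) •
        ∑ i, star (α (χ i)) * β (b i k) * α (χ i)‖ ≤ M := fun k => by
      rw [norm_smul, norm_pow, Complex.norm_I, one_pow, one_mul]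
      exact (norm_sum_conjugate_le Finset.univ (fun i => α (χ i)) (fun i => β (b i k))
        (fun i => hβ0 i k) (fun i => hβM i k)).trans (mul_le_of_le_one_right (norm_nonneg _) hone)
    refine (Finset.sum_le_sum fun k _ => hk k).trans ?_
    simp
  calc ‖productMap α β z‖ ≤ ‖productMap α β z - y‖ + ‖y‖ := norm_le_norm_sub_add _ _
    _ ≤ 4 * ‖tensorMap X π z‖ + δ := by linarith

/-- If `α : C₀(X) → D` and `β : B → D` commute and `α(f) β(b) = 0` for compactly supported `f` and
`b` in the kernel of the surjection `π : B → A`, then `f ⊗ π(b) ↦ α(f) β(b)` defines a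
⋆-homomorphism `C₀(X; A) → D`. -/
theorem exists_product_starHom (hπ : Function.Surjective π)
    (hcomm : ∀ f b, Commute (α f) (β b))
    (hker : ∀ (f : C₀(X, ℂ)) b, HasCompactSupport f → π b = 0 → α f * β b = 0) :
    ∃ Θ : C₀(X, A) →⋆ₙₐ[ℂ] D, ∀ f b, Θ (zeroAtInftyTensor f (π b)) = α f * β b := by
  let T : C₀(X, A) →L[ℂ] D := (productMap α β).extendOfNorm (tensorMap X π)
  have hT : ∀ f b, T (zeroAtInftyTensor f (π b)) = α f * β b := fun f b => by
    rw [← tensorMap_single, LinearMap.extendOfNorm_eq (denseRange_tensorMap π hπ)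
      ⟨4, norm_productMap_le α β π hπ hcomm hker⟩]
    simp [productMap]
  have hmul : ∀ F F', T (F * F') = T F * T F' := by
    intro F F'
    -- Multiplicativity is a closed linear condition in each variable separately, so it is reduced
    -- to elementary tensors one variable at a time.
    let S₁ : Submodule ℂ C₀(X, A) :=
      { carrier := {F | T (F * F') = T F * T F'}
        zero_mem' := by simp
        add_mem' := fun {x y} (hx : _ = _) (hy : _ = _) => by
          change T ((x + y) * F') = T (x + y) * T F'
          rw [add_mul, map_add, map_add, add_mul, hx, hy]
        smul_mem' := fun c x (hx : _ = _) => by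
          change T ((c • x) * F') = T (c • x) * T F'
          rw [smul_mul_assoc, map_smul, map_smul, smul_mul_assoc, hx] }
    refine zeroAtInfty_induction hπ S₁ (isClosed_eq (by fun_prop) (by fun_prop)) (fun f b => ?_) F
    let S₂ : Submodule ℂ C₀(X, A) :=
      { carrier := {F' | T (zeroAtInftyTensor f (π b) * F') = T (zeroAtInftyTensor f (π b)) * T F'}
        zero_mem' := by simp
        add_mem' := fun {x y} (hx : _ = _) (hy : _ = _) => by
          change T (_ * (x + y)) = _ * T (x + y)
          rw [mul_add, map_add, map_add, mul_add, hx, hy]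
        smul_mem' := fun c x (hx : _ = _) => by
          change T (_ * (c • x)) = _ * T (c • x)
          rw [mul_smul_comm, map_smul, map_smul, mul_smul_comm, hx] }
    refine zeroAtInfty_induction hπ S₂ (isClosed_eq (by fun_prop) (by fun_prop)) (fun f' b' => ?_)
      F'
    change T (zeroAtInftyTensor f (π b) * zeroAtInftyTensor f' (π b')) = _
    have h : zeroAtInftyTensor f (π b) * zeroAtInftyTensor f' (π b') =
        zeroAtInftyTensor (f * f') (π (b * b')) := by
      ext x
      change (f x • π b) * (f' x • π b') = (f x * f' x) • π (b * b')
      rw [smul_mul_smul_comm, map_mul]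
    rw [h, hT, hT, hT, map_mul, map_mul, (hcomm f' b).mul_mul_mul_comm]
  have hstar : ∀ F, T (star F) = star (T F) := by
    intro F
    let S : Submodule ℂ C₀(X, A) :=
      { carrier := {F | T (star F) = star (T F)}
        zero_mem' := by simp
        add_mem' := fun {x y} (hx : _ = _) (hy : _ = _) => by
          change T (star (x + y)) = star (T (x + y))
          rw [star_add, map_add, map_add, star_add, hx, hy]
        smul_mem' := fun c x (hx : _ = _) => by
          change T (star (c • x)) = star (T (c • x))
          rw [star_smul, map_smul, map_smul, star_smul, hx] }
    refine zeroAtInfty_induction hπ S (isClosed_eq (by fun_prop) (by fun_prop)) (fun f b => ?_) F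
    change T (star (zeroAtInftyTensor f (π b))) = star (T (zeroAtInftyTensor f (π b)))
    have h : star (zeroAtInftyTensor f (π b)) = zeroAtInftyTensor (star f) (π (star b)) := by
      ext x
      change star (f x • π b) = star (f x) • π (star b)
      rw [star_smul, map_star]
    rw [h, hT, hT, map_star, map_star, star_mul, ← star_mul, ← star_mul, (hcomm f b).eq]
  exact ⟨{ toFun := T, map_smul' := map_smul T, map_zero' := map_zero T, map_add' := map_add T,
           map_mul' := hmul, map_star' := hstar }, hT⟩

end CoreTensor

/-! ### Functional calculus for functions on the open unit interval -/

/-- Only points outside the open interval need an argument. A compact set off which `f` is small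
stays closed in `ℝ`, so its complement is a neighbourhood of each such point, the endpoints
included. -/
theorem continuous_extend_zeroAtInfty (f : C₀(Set.Ioo (0 : ℝ) 1, ℂ)) :
    Continuous (Function.extend ((↑) : Set.Ioo (0 : ℝ) 1 → ℝ) f 0) := by
  have hval : Topology.IsOpenEmbedding ((↑) : Set.Ioo (0 : ℝ) 1 → ℝ) :=
    isOpen_Ioo.isOpenEmbedding_subtypeVal
  have hext : ∀ x : Set.Ioo (0 : ℝ) 1,
      Function.extend ((↑) : Set.Ioo (0 : ℝ) 1 → ℝ) f 0 x = f x := fun x =>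
    Subtype.val_injective.extend_apply f (0 : ℝ → ℂ) x
  rw [continuous_iff_continuousAt]
  intro t
  by_cases ht : t ∈ Set.Ioo (0 : ℝ) 1
  · rw [show t = ((⟨t, ht⟩ : Set.Ioo (0 : ℝ) 1) : ℝ) from rfl, ← hval.continuousAt_iff]
    exact f.continuous.continuousAt.congr (Eventually.of_forall fun x => (hext x).symm)
  · have h0 : ∀ s ∉ Set.Ioo (0 : ℝ) 1,
        Function.extend ((↑) : Set.Ioo (0 : ℝ) 1 → ℝ) f 0 s = 0 := fun s hs =>
      Function.extend_apply' f (0 : ℝ → ℂ) s fun ⟨x, hx⟩ => hs (hx ▸ x.2)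
    rw [ContinuousAt, h0 t ht, Metric.tendsto_nhds]
    intro ε hε
    obtain ⟨K, hK, hKf⟩ := mem_cocompact.1 (Metric.tendsto_nhds.1 f.zero_at_infty' ε hε)
    have hKc : IsClosed (((↑) : Set.Ioo (0 : ℝ) 1 → ℝ) '' K) :=
      (hK.image continuous_subtype_val).isClosed
    have htK : t ∉ ((↑) : Set.Ioo (0 : ℝ) 1 → ℝ) '' K := fun ⟨x, _, hx⟩ => ht (hx ▸ x.2)
    filter_upwards [hKc.isOpen_compl.mem_nhds htK] with s hs
    by_cases hsI : s ∈ Set.Ioo (0 : ℝ) 1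
    · have hsK : (⟨s, hsI⟩ : Set.Ioo (0 : ℝ) 1) ∈ Kᶜ := fun h => hs ⟨_, h, rfl⟩
      have h := hKf hsK
      rwa [show s = ((⟨s, hsI⟩ : Set.Ioo (0 : ℝ) 1) : ℝ) from rfl, hext]
    · rw [h0 s hsI, dist_self]
      exact hε

theorem continuous_extend_zeroAtInfty_re (f : C₀(Set.Ioo (0 : ℝ) 1, ℂ)) :
    Continuous fun z : ℂ => Function.extend ((↑) : Set.Ioo (0 : ℝ) 1 → ℝ) f 0 z.re :=
  (continuous_extend_zeroAtInfty f).comp Complex.continuous_re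

theorem extend_zeroAtInfty_of_notMem (f : C₀(Set.Ioo (0 : ℝ) 1, ℂ)) {t : ℝ}
    (ht : t ∉ Set.Ioo (0 : ℝ) 1) : Function.extend ((↑) : Set.Ioo (0 : ℝ) 1 → ℝ) f 0 t = 0 :=
  Function.extend_apply' f (0 : ℝ → ℂ) t fun ⟨x, hx⟩ => ht (hx ▸ x.2)

theorem extend_zeroAtInfty_of_mem (f : C₀(Set.Ioo (0 : ℝ) 1, ℂ)) {t : ℝ}
    (ht : t ∈ Set.Ioo (0 : ℝ) 1) :
    Function.extend ((↑) : Set.Ioo (0 : ℝ) 1 → ℝ) f 0 t = f ⟨t, ht⟩ :=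
  Subtype.val_injective.extend_apply f (0 : ℝ → ℂ) ⟨t, ht⟩

theorem extend_zeroAtInfty_zero (f : C₀(Set.Ioo (0 : ℝ) 1, ℂ)) :
    Function.extend ((↑) : Set.Ioo (0 : ℝ) 1 → ℝ) f 0 (0 : ℂ).re = 0 :=
  extend_zeroAtInfty_of_notMem f (by simp)

section IntervalCalc

variable {C D : Type*} [NonUnitalCStarAlgebra C] [NonUnitalCStarAlgebra D]

/-- Naturality of the non-unital calculus, available because the extended function is continuous and
vanishes at `0`. It transports `f(·)` along inclusions, quotient maps, evaluations, the action and
the grading. -/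
theorem map_intervalCalc (φ : C →⋆ₙₐ[ℂ] D) (f : C₀(Set.Ioo (0 : ℝ) 1, ℂ)) {a : C}
    (ha : IsSelfAdjoint a) : φ (intervalCalc f a) = intervalCalc f (φ a) :=
  NonUnitalStarAlgHomClass.map_cfcₙ (S := ℂ) φ _ a
    (continuous_extend_zeroAtInfty_re f).continuousOn (extend_zeroAtInfty_zero f)
    (starHom_lipschitz φ).continuous ha.isStarNormal (ha.map φ).isStarNormal

/-- The ⋆-homomorphism `f ↦ f(h)` on `C₀((0,1))`, for a self-adjoint element `h`. -/
def intervalHom (h : D) : C₀(Set.Ioo (0 : ℝ) 1, ℂ) →⋆ₙₐ[ℂ] D where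
  toFun f := intervalCalc f h
  map_smul' c f := by
    refine Eq.trans ?_ (cfcₙ_smul c _ h (continuous_extend_zeroAtInfty_re f).continuousOn
      (extend_zeroAtInfty_zero f))
    refine congrArg (fun F => cfcₙ F h) (funext fun z => ?_)
    by_cases hz : z.re ∈ Set.Ioo (0 : ℝ) 1
    · simp only [extend_zeroAtInfty_of_mem _ hz]; rfl
    · simp only [extend_zeroAtInfty_of_notMem _ hz, smul_zero]
  map_zero' := by
    refine Eq.trans ?_ (cfcₙ_zero ℂ h)
    refine congrArg (fun F => cfcₙ F h) (funext fun z => ?_)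
    by_cases hz : z.re ∈ Set.Ioo (0 : ℝ) 1
    · simp only [extend_zeroAtInfty_of_mem _ hz]; rfl
    · simp only [extend_zeroAtInfty_of_notMem _ hz]; rfl
  map_add' f g := by
    refine Eq.trans ?_ (cfcₙ_add _ _ h (continuous_extend_zeroAtInfty_re f).continuousOn
      (extend_zeroAtInfty_zero f) (continuous_extend_zeroAtInfty_re g).continuousOn
      (extend_zeroAtInfty_zero g))
    refine congrArg (fun F => cfcₙ F h) (funext fun z => ?_)
    by_cases hz : z.re ∈ Set.Ioo (0 : ℝ) 1
    · simp only [extend_zeroAtInfty_of_mem _ hz]; rfl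
    · simp only [extend_zeroAtInfty_of_notMem _ hz, add_zero]
  map_mul' f g := by
    refine Eq.trans ?_ (cfcₙ_mul _ _ h (continuous_extend_zeroAtInfty_re f).continuousOn
      (extend_zeroAtInfty_zero f) (continuous_extend_zeroAtInfty_re g).continuousOn
      (extend_zeroAtInfty_zero g))
    refine congrArg (fun F => cfcₙ F h) (funext fun z => ?_)
    by_cases hz : z.re ∈ Set.Ioo (0 : ℝ) 1
    · simp only [extend_zeroAtInfty_of_mem _ hz]; rfl
    · simp only [extend_zeroAtInfty_of_notMem _ hz, mul_zero]
  map_star' f := by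
    refine Eq.trans ?_ (cfcₙ_star _ h)
    refine congrArg (fun F => cfcₙ F h) (funext fun z => ?_)
    by_cases hz : z.re ∈ Set.Ioo (0 : ℝ) 1
    · simp only [extend_zeroAtInfty_of_mem _ hz]; rfl
    · simp only [extend_zeroAtInfty_of_notMem _ hz, star_zero]

theorem commute_intervalCalc {h d : D} (hh : IsSelfAdjoint h) (hd : Commute h d)
    (f : C₀(Set.Ioo (0 : ℝ) 1, ℂ)) : Commute (intervalCalc f h) d :=
  hd.cfcₙ (hh.star_eq.symm ▸ hd) _

/-- If `h` is self-adjoint and acts as the identity on `d`, then `f(h) d = 0` for `f ∈ C_c((0,1))`: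
write `f = g - g · id`. -/
theorem intervalCalc_mul_eq_zero {h d : D} (hh : IsSelfAdjoint h) (hd : h * d = d)
    (f : C₀(Set.Ioo (0 : ℝ) 1, ℂ)) (hf : HasCompactSupport f) : intervalCalc f h * d = 0 := by
  have hne : ∀ t : Set.Ioo (0 : ℝ) 1, (1 - (t : ℝ) : ℂ) ≠ 0 := fun t => by
    rw [← Complex.ofReal_one, ← Complex.ofReal_sub]
    exact Complex.ofReal_ne_zero.2 (sub_pos.2 t.2.2).ne'
  -- The factor `(1 - t)⁻¹` is unbounded near `1`; compact support of `f` keeps the quotient in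
  -- `C₀((0,1))`.
  let g : C₀(Set.Ioo (0 : ℝ) 1, ℂ) :=
    { toFun := fun t => f t * (1 - (t : ℝ) : ℂ)⁻¹
      continuous_toFun := f.continuous.mul ((continuous_const.sub
        (Complex.continuous_ofReal.comp continuous_subtype_val)).inv₀ hne)
      zero_at_infty' := HasCompactSupport.is_zero_at_infty hf.mul_right }
  have hid : ContinuousOn (fun z : ℂ => z) (quasispectrum ℂ h) := continuous_id.continuousOn
  have hg := continuous_extend_zeroAtInfty_re g
  have hfg : intervalCalc f h = intervalCalc g h - intervalCalc g h * h := by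
    have hmul := cfcₙ_mul _ _ h hg.continuousOn (extend_zeroAtInfty_zero g) hid rfl
    rw [cfcₙ_id' ℂ h hh.isStarNormal] at hmul
    rw [intervalCalc, intervalCalc, ← hmul, ← cfcₙ_sub _
      (fun z : ℂ => Function.extend ((↑) : Set.Ioo (0 : ℝ) 1 → ℝ) g 0 z.re * z) h hg.continuousOn
      (extend_zeroAtInfty_zero g) (hg.continuousOn.mul hid) (mul_zero _)]
    refine cfcₙ_congr fun z hz => ?_
    -- The quasispectrum is real, so passing to the real part in `intervalCalc` loses nothing.
    have hzre : (z.re : ℂ) = z := hh.quasispectrumRestricts.rightInvOn hz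
    by_cases hz : z.re ∈ Set.Ioo (0 : ℝ) 1
    · simp only [extend_zeroAtInfty_of_mem _ hz]
      change f _ = f _ * (1 - (z.re : ℂ))⁻¹ - f _ * (1 - (z.re : ℂ))⁻¹ * z
      have h1 := hne ⟨_, hz⟩
      rw [hzre] at h1 ⊢
      field_simp
    · simp only [extend_zeroAtInfty_of_notMem _ hz, zero_mul, sub_zero]
  rw [hfg, sub_mul, mul_assoc, hd, sub_self]

end IntervalCalc

/-! ### Generalities on asymptotic algebras -/

namespace AsympAlg

variable {X : Type*} [TopologicalSpace X] {l : Filter X} {B C : Type*} [NonUnitalCStarAlgebra B]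
  [NonUnitalCStarAlgebra C]

variable (l B) in
/-- The quotient map `C_b(X; B) → C_b(X; B) / C₀(X; B)` as a ⋆-homomorphism. -/
def mkHom : (X →ᵇ B) →⋆ₙₐ[ℂ] AsympAlg l B where
  toFun := mk l
  map_smul' _ _ := rfl
  map_zero' := rfl
  map_add' _ _ := rfl
  map_mul' _ _ := rfl
  map_star' _ := rfl

variable (l B) in
/-- The inclusion of the constant functions. -/
def constHom : B →⋆ₙₐ[ℂ] AsympAlg l B where
  toFun b := mk l (BoundedContinuousFunction.const X b)
  map_smul' _ _ := rfl
  map_zero' := rfl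
  map_add' _ _ := rfl
  map_mul' _ _ := rfl
  map_star' _ := rfl

/-- An injective ⋆-homomorphism is isometric, so it detects convergence to zero of a difference of
representatives. -/
theorem mapHom_injective {φ : B →⋆ₙₐ[ℂ] C} (hφ : Function.Injective φ) :
    Function.Injective (mapHom l φ) := by
  intro x y hxy
  obtain ⟨f, rfl⟩ := mk_surjective x
  obtain ⟨g, rfl⟩ := mk_surjective y
  rw [mapHom_mk, mapHom_mk, mk_eq_mk] at hxy
  rw [mk_eq_mk]
  refine tendsto_zero_iff_norm_tendsto_zero.2 ((tendsto_zero_iff_norm_tendsto_zero.1 hxy).congr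
    fun x => ?_)
  change ‖φ (f x) - φ (g x)‖ = _
  rw [← map_sub, NonUnitalStarAlgHom.norm_map φ hφ]

end AsympAlg

/-- The evaluation of bounded continuous functions at a point, as a ⋆-homomorphism. -/
def bcfEval {X : Type*} [TopologicalSpace X] (B : Type*) [NonUnitalCStarAlgebra B] (x : X) :
    (X →ᵇ B) →⋆ₙₐ[ℂ] B where
  toFun f := f x
  map_smul' _ _ := rfl
  map_zero' := rfl
  map_add' _ _ := rfl
  map_mul' _ _ := rfl
  map_star' _ := rfl

/-- A ⋆-homomorphism with values in the range of an injective ⋆-homomorphism factors. -/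
theorem exists_starHom_factorization {A B C : Type*} [NonUnitalCStarAlgebra A]
    [NonUnitalCStarAlgebra B] [NonUnitalCStarAlgebra C] (ψ : A →⋆ₙₐ[ℂ] C) (φ : B →⋆ₙₐ[ℂ] C)
    (hφ : Function.Injective φ) (h : ∀ a, ψ a ∈ Set.range φ) :
    ∃ χ : A →⋆ₙₐ[ℂ] B, ∀ a, φ (χ a) = ψ a := by
  choose χ hχ using h
  exact ⟨{ toFun := χ
           map_smul' := fun c a => hφ (by rw [map_smul, hχ, hχ, map_smul]; rfl)
           map_zero' := hφ (by rw [hχ, map_zero, map_zero])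
           map_add' := fun a b => hφ (by rw [map_add, hχ, hχ, hχ, map_add])
           map_mul' := fun a b => hφ (by rw [map_mul, hχ, hχ, hχ, map_mul])
           map_star' := fun a => hφ (by rw [map_star, hχ, hχ, map_star]) }, hχ⟩

/-- If `φ(J) d ⊆ φ(J)` for an injective ⋆-homomorphism `φ : J → B`, then right multiplication by `d`
is a bounded operator on `J`. -/
theorem exists_right_mul {J B : Type*} [NonUnitalCStarAlgebra J] [NonUnitalCStarAlgebra B]
    (φ : J →⋆ₙₐ[ℂ] B) (hφ : Function.Injective φ) (d : B) (hd : ∀ j, φ j * d ∈ Set.range φ) :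
    ∃ R : J →L[ℂ] J, ∀ j, φ (R j) = φ j * d := by
  choose R hR using hd
  let R' : J →ₗ[ℂ] J :=
    { toFun := R
      map_add' := fun a b => hφ (by rw [map_add, hR, hR, hR, map_add, add_mul])
      map_smul' := fun c a => hφ (by
        rw [RingHom.id_apply, map_smul, hR, hR, map_smul, smul_mul_assoc]) }
  refine ⟨R'.mkContinuous ‖d‖ fun j => ?_, hR⟩
  change ‖R j‖ ≤ _
  rw [← NonUnitalStarAlgHom.norm_map φ hφ, hR, mul_comm, ← NonUnitalStarAlgHom.norm_map φ hφ j]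
  exact norm_mul_le _ _

/-- The composition of a bounded continuous function with a bounded operator. -/
def bcfCompLeft {X E F : Type*} [TopologicalSpace X] [NormedAddCommGroup E] [NormedSpace ℂ E]
    [NormedAddCommGroup F] [NormedSpace ℂ F] (R : E →L[ℂ] F) (f : X →ᵇ E) : X →ᵇ F :=
  f.comp R R.lipschitz

/-! ### The extension morphism of an asymptotically central asymptotic unit -/

instance : LocallyCompactSpace (Set.Ioo (0 : ℝ) 1) := isOpen_Ioo.locallyCompactSpace

theorem susp_induction {B A : Type*} [NonUnitalCStarAlgebra B] [NonUnitalCStarAlgebra A]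
    {π : B →⋆ₙₐ[ℂ] A} (hπ : Function.Surjective π) (S : Submodule ℂ (Susp A))
    (hS : IsClosed (S : Set (Susp A))) (h : ∀ f b, elemTensor f (π b) ∈ S) (F : Susp A) : F ∈ S :=
  zeroAtInfty_induction hπ S hS h F

/-- ⋆-homomorphisms on the suspension that agree on elementary tensors are equal. -/
theorem susp_hom_ext {B A D : Type*} [NonUnitalCStarAlgebra B] [NonUnitalCStarAlgebra A]
    [NonUnitalCStarAlgebra D] {π : B →⋆ₙₐ[ℂ] A} (hπ : Function.Surjective π)
    (φ ψ : Susp A →⋆ₙₐ[ℂ] D) (h : ∀ f b, φ (elemTensor f (π b)) = ψ (elemTensor f (π b))) :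
    φ = ψ := by
  refine NonUnitalStarAlgHom.ext fun F => ?_
  let S : Submodule ℂ (Susp A) :=
    { carrier := {F | φ F = ψ F}
      zero_mem' := by simp
      add_mem' := fun {x y} (hx : _ = _) (hy : _ = _) => by
        change φ (x + y) = ψ (x + y)
        rw [map_add, map_add, hx, hy]
      smul_mem' := fun c x (hx : _ = _) => by
        change φ (c • x) = ψ (c • x)
        rw [map_smul, map_smul, hx] }
  exact susp_induction hπ S
    (isClosed_eq (starHom_lipschitz φ).continuous (starHom_lipschitz ψ).continuous) h F

/-- Let `V : X → J` be a bounded continuous self-adjoint function which asymptotically commutes with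
`c(B)`, is asymptotically invariant, and asymptotically acts as the identity on `c(ker π)`. Then
there is a morphism that maps `f ⊗ π(b)` to the class of `x ↦ f(V x) c(b)`. -/
theorem exists_extension_morphism {X : Type*} [TopologicalSpace X] {l : Filter X}
    {G : Type*} [Group G] {J B B' A : Type*}
    [NonUnitalCStarAlgebra J] [GradedGCStarAlgebra G J]
    [NonUnitalCStarAlgebra B] [GradedGCStarAlgebra G B]
    [NonUnitalCStarAlgebra B'] [GradedGCStarAlgebra G B']
    [NonUnitalCStarAlgebra A] [GradedGCStarAlgebra G A]
    (ι : GStarHom G J B') (c : GStarHom G B B') (π : GStarHom G B A)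
    (hι : Function.Injective ι.toHom) (hπ : Function.Surjective π.toHom)
    (hideal : ∀ j b, ι.toHom j * c.toHom b ∈ Set.range ι.toHom)
    (V : X →ᵇ J) (hV : ∀ x, IsSelfAdjoint (V x))
    (hcomm : ∀ b, Tendsto (fun x => ι.toHom (V x) * c.toHom b - c.toHom b * ι.toHom (V x)) l (𝓝 0))
    (hunit : ∀ b, π.toHom b = 0 →
      Tendsto (fun x => ι.toHom (V x) * c.toHom b - c.toHom b) l (𝓝 0))
    (hact : ∀ g : G, Tendsto (fun x => gact g (V x) - V x) l (𝓝 0))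
    (hgrade : Tendsto (fun x => gradeAut G (V x) - V x) l (𝓝 0)) :
    ∃ Φ : GStarHom G (Susp A) (AsympAlg l J), ∀ f b, ∃ F : X →ᵇ J,
      (∀ x, ι.toHom (F x) = intervalCalc f (ι.toHom (V x)) * c.toHom b) ∧
      Φ.toHom (elemTensor f (π.toHom b)) = AsympAlg.mk l F := by
  have hVsa : IsSelfAdjoint V := by
    rw [isSelfAdjoint_iff]
    ext x
    exact (hV x).star_eq
  set h : AsympAlg l J := AsympAlg.mk l V with h_def
  have hsa : IsSelfAdjoint h := hVsa.map (AsympAlg.mkHom l J)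
  set I : AsympAlg l J →⋆ₙₐ[ℂ] AsympAlg l B' := AsympAlg.mapHom l ι.toHom with hI_def
  have hI : Function.Injective I := AsympAlg.mapHom_injective hι
  -- The calculus is carried out over `J` and then pushed forward, so that all its values visibly
  -- come from `J`.
  let α : C₀(Set.Ioo (0 : ℝ) 1, ℂ) →⋆ₙₐ[ℂ] AsympAlg l B' := I.comp (intervalHom h)
  let β : B →⋆ₙₐ[ℂ] AsympAlg l B' := (AsympAlg.constHom l B').comp c.toHom
  have hα : ∀ f, α f = intervalCalc f (I h) := fun f => map_intervalCalc I f hsa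
  -- Passing to the quotient turns the asymptotic relations into exact ones, as
  -- `exists_product_starHom` requires.
  have hcomm' : ∀ b, Commute (I h) (β b) := fun b => AsympAlg.mk_eq_mk.2 (hcomm b)
  have hunit' : ∀ b, π.toHom b = 0 → I h * β b = β b := fun b hb =>
    AsympAlg.mk_eq_mk.2 (hunit b hb)
  obtain ⟨Θ, hΘ⟩ := exists_product_starHom α β π.toHom hπ
    (fun f b => by
      rw [hα]
      exact commute_intervalCalc (hsa.map I) (hcomm' b) f)
    (fun f b hf hb => by
      rw [hα]
      exact intervalCalc_mul_eq_zero (hsa.map I) (hunit' b hb) f hf)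
  have hvalue : ∀ f b, ∃ F : X →ᵇ J,
      (∀ x, ι.toHom (F x) = intervalCalc f (ι.toHom (V x)) * c.toHom b) ∧
      I (AsympAlg.mk l F) = α f * β b := by
    intro f b
    -- Right multiplication by `c(b)` is a bounded operator on `J`, so composing with it yields an
    -- honest bounded continuous `J`-valued representative.
    obtain ⟨R, hR⟩ := exists_right_mul ι.toHom hι (c.toHom b) fun j => hideal j b
    refine ⟨bcfCompLeft R (intervalCalc f V), fun x => ?_, ?_⟩
    · change ι.toHom (R (bcfEval J x (intervalCalc f V))) = _
      rw [hR, map_intervalCalc _ f hVsa, map_intervalCalc _ f (hVsa.map _)]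
      rfl
    · have h1 : α f = I (AsympAlg.mk l (intervalCalc f V)) :=
        congrArg I (map_intervalCalc (AsympAlg.mkHom l J) f hVsa).symm
      rw [h1]
      refine congrArg (AsympAlg.mk l) ?_
      ext x
      exact hR _
  -- An isometric image of a complete space is closed, so it suffices to locate the values on
  -- elementary tensors.
  have hclosed : IsClosed (Set.range I) := (NonUnitalStarAlgHom.isometry I hI).isClosedEmbedding
    |>.isClosed_range
  have hrange : ∀ F, Θ F ∈ Set.range I := by
    intro F
    let S : Submodule ℂ (Susp A) :=
      { carrier := {F | Θ F ∈ Set.range I}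
        zero_mem' := ⟨0, by simp⟩
        add_mem' := fun {x y} ⟨x', hx⟩ ⟨y', hy⟩ => ⟨x' + y', by rw [map_add, map_add, hx, hy]⟩
        smul_mem' := fun c x ⟨x', hx⟩ => ⟨c • x', by rw [map_smul, map_smul, hx]⟩ }
    refine susp_induction hπ S (hclosed.preimage (starHom_lipschitz Θ).continuous)
      (fun f b => ?_) F
    obtain ⟨F, -, hF⟩ := hvalue f b
    exact ⟨_, hF.trans (hΘ f b).symm⟩
  obtain ⟨Φ, hΦ⟩ := exists_starHom_factorization Θ I hI hrange
  have hΦe : ∀ f b, I (Φ (elemTensor f (π.toHom b))) = α f * β b := fun f b =>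
    (hΦ _).trans (hΘ f b)
  have hact_h : ∀ g : G, gact g h = h := fun g => AsympAlg.mk_eq_mk.2 (hact g)
  have hgrade_h : gradeAut G h = h := AsympAlg.mk_eq_mk.2 hgrade
  have hIact : ∀ (g : G) x, I (gact g x) = gact g (I x) := (AsympAlg.map l ι).map_act
  have hIgrade : ∀ x, I (gradeAut G x) = gradeAut G (I x) := (AsympAlg.map l ι).map_grade
  have hαact : ∀ (g : G) f, gact g (α f) = α f := fun g f => by
    rw [hα, map_intervalCalc _ f (hsa.map I), ← hIact, hact_h]
  have hαgrade : ∀ f, gradeAut G (α f) = α f := fun f => by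
    rw [hα, map_intervalCalc _ f (hsa.map I), ← hIgrade, hgrade_h]
  have hβact : ∀ (g : G) b, gact g (β b) = β (gact g b) := fun g b => by
    refine congrArg (AsympAlg.mk l) ?_
    ext x
    exact (c.map_act g b).symm
  have hβgrade : ∀ b, gradeAut G (β b) = β (gradeAut G b) := fun b => by
    refine congrArg (AsympAlg.mk l) ?_
    ext x
    exact (c.map_grade b).symm
  refine ⟨⟨Φ, fun g F => ?_, fun F => ?_⟩, fun f b => ?_⟩
  -- After the injection `I`, an elementary tensor becomes `α f * β b`: the first factor is
  -- invariant because `h` is, and the second is moved only through `b`.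
  · refine DFunLike.congr_fun (susp_hom_ext hπ (Φ.comp (gact g)) ((gact g).comp Φ)
      fun f b => hI ?_) F
    have h1 : gact g (elemTensor f (π.toHom b)) = elemTensor f (π.toHom (gact g b)) := by
      ext t
      change gact g (f t • π.toHom b) = f t • π.toHom (gact g b)
      rw [map_smul, π.map_act]
    change I (Φ (gact g (elemTensor f (π.toHom b)))) =
      I (gact g (Φ (elemTensor f (π.toHom b))))
    rw [h1, hΦe, hIact, hΦe, map_mul, hαact, hβact]
  · refine DFunLike.congr_fun (susp_hom_ext hπ (Φ.comp (gradeAut G)) ((gradeAut G).comp Φ)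
      fun f b => hI ?_) F
    have h1 : gradeAut G (elemTensor f (π.toHom b)) =
        elemTensor f (π.toHom (gradeAut G b)) := by
      ext t
      change gradeAut G (f t • π.toHom b) = f t • π.toHom (gradeAut G b)
      rw [map_smul, π.map_grade]
    change I (Φ (gradeAut G (elemTensor f (π.toHom b)))) =
      I (gradeAut G (Φ (elemTensor f (π.toHom b))))
    rw [h1, hΦe, hIgrade, hΦe, map_mul, hαgrade, hβgrade]
  · obtain ⟨F, hF, hF'⟩ := hvalue f b
    exact ⟨F, hF, hI ((hΦe f b).trans hF'.symm)⟩

/-! ### Affine extensions -/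

namespace FullSimplex

section AffineExt

variable {S V W : Type*} [AddCommGroup V] [Module ℂ V] [AddCommGroup W] [Module ℂ W]

theorem map_affineExt (L : V →ₗ[ℂ] W) (u : S → V) (x : FullSimplex S) :
    L (affineExt u x) = affineExt (fun s => L (u s)) x := by
  simp only [affineExt, Finsupp.sum, map_sum, map_smul]

theorem affineExt_map {T : Type*} (α : S → T) (u : T → V) (x : FullSimplex S) :
    affineExt u (map α x) = affineExt (fun s => u (α s)) x :=
  Finsupp.sum_mapDomain_index (fun _ => by simp) (fun _ _ _ => by simp [add_smul])

theorem affineExt_incl (u : S → V) (F : Finset S) (p : stdSimplex ℝ F) :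
    affineExt u (incl F p) = ∑ i : F, ((p.1 i : ℝ) : ℂ) • u i := by
  change (∑ i : F, Finsupp.single (i : S) (p.1 i)).sum _ = _
  rw [← Finsupp.sum_finsetSum_index (fun _ => by simp) (fun _ _ _ => by simp [add_smul])]
  exact Finset.sum_congr rfl fun i _ => Finsupp.sum_single_index (by simp)

/-- The weak topology reduces continuity to finite simplices, where the affine extension is a finite
sum with continuous coefficients. -/
theorem continuous_affineExt [TopologicalSpace V] [ContinuousAdd V] [ContinuousSMul ℂ V]
    (u : S → V) : Continuous (affineExt u) := by
  rw [continuous_iff]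
  intro F
  simp only [affineExt_incl]
  refine continuous_finsetSum _ fun i _ => Continuous.smul (Complex.continuous_ofReal.comp ?_)
    continuous_const
  exact (continuous_apply i).comp continuous_subtype_val

theorem affineExt_mem {C : Set V} (hC : Convex ℝ C) (u : S → V) (x : FullSimplex S)
    (h : ∀ s ∈ x.coeff.support, u s ∈ C) : affineExt u x ∈ C := by
  have h1 := hC.sum_mem (t := x.coeff.support) (w := fun s => x.coeff s) (z := u)
    (fun s _ => x.nonneg s) x.sum_eq_one h
  simpa only [affineExt, Finsupp.sum, Complex.coe_smul] using h1

end AffineExt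

/-- Balls are convex: once the tail of the net lies in a ball, so does the image of the face it
spans. Through this, asymptotic properties of the net pass to the simplex. -/
theorem tendsto_affineExt {S V : Type*} [Preorder S] [IsDirectedOrder S] [Nonempty S]
    [NormedAddCommGroup V] [NormedSpace ℂ V] {u : S → V} {a : V} (h : Tendsto u atTop (𝓝 a)) :
    Tendsto (affineExt u) (tailFilter S) (𝓝 a) := by
  rw [Metric.tendsto_nhds]
  intro ε hε
  obtain ⟨m, hm⟩ := eventually_atTop.1 (Metric.tendsto_nhds.1 h ε hε)
  refine mem_of_superset (mem_iInf_of_mem m (mem_principal_self _)) fun x hx => ?_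
  exact affineExt_mem (convex_ball a ε) u x fun s hs => hm s (hx s hs)

end FullSimplex

theorem IsCofinalMap.tendsto_atTop {m n : DirectedSet.{w}} {α : m → n} (hα : IsCofinalMap α) :
    Tendsto α atTop atTop :=
  Filter.tendsto_atTop_atTop.2 hα

/-! ### Linear paths -/

section LinearPath

variable {V : Type*} [NormedAddCommGroup V] [NormedSpace ℂ V]

/-- The straight path from `a` to `b`. -/
def linearPath (a b : V) : C(unitInterval, V) where
  toFun t := ((1 - (t : ℝ) : ℝ) : ℂ) • a + ((t : ℝ) : ℂ) • b
  continuous_toFun := by fun_prop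

theorem linearPath_apply (a b : V) (t : unitInterval) :
    linearPath a b t = ((1 - (t : ℝ) : ℝ) : ℂ) • a + ((t : ℝ) : ℂ) • b := rfl

theorem linearPath_zero (a b : V) : linearPath a b 0 = a := by simp [linearPath_apply]

theorem linearPath_one (a b : V) : linearPath a b 1 = b := by simp [linearPath_apply]

theorem norm_linearPath_le (a b : V) : ‖linearPath a b‖ ≤ ‖a‖ + ‖b‖ := by
  rw [ContinuousMap.norm_le _ (by positivity)]
  intro t
  rw [linearPath_apply]
  refine (norm_add_le _ _).trans (add_le_add ?_ ?_)
  · rw [norm_smul, Complex.norm_real, Real.norm_of_nonneg (sub_nonneg.2 t.2.2)]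
    exact mul_le_of_le_one_left (norm_nonneg _) (by linarith [t.2.1])
  · rw [norm_smul, Complex.norm_real, Real.norm_of_nonneg t.2.1]
    exact mul_le_of_le_one_left (norm_nonneg _) t.2.2

/-- The endpoint norms bound the path in the supremum norm, so convergence is uniform in the path
parameter. -/
theorem tendsto_linearPath_zero {ι : Type*} {l : Filter ι} {a b : ι → V}
    (ha : Tendsto (fun i => ‖a i‖) l (𝓝 0)) (hb : Tendsto (fun i => ‖b i‖) l (𝓝 0)) :
    Tendsto (fun i => linearPath (a i) (b i)) l (𝓝 0) := by
  refine squeeze_zero_norm (fun i => norm_linearPath_le (a i) (b i)) ?_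
  simpa using ha.add hb

end LinearPath

section PathAlgebra

variable {G : Type*} [Group G] {J B : Type*} [NonUnitalCStarAlgebra J] [GradedGCStarAlgebra G J]
  [NonUnitalCStarAlgebra B] [GradedGCStarAlgebra G B]

/-- The morphism `C([0,1]; J) → C([0,1]; B)` induced by a morphism `J → B`. -/
def pathGStarHom (φ : GStarHom G J B) : GStarHom G C(unitInterval, J) C(unitInterval, B) where
  toHom := pathMap φ.toHom
  map_act g f := by ext t; exact φ.map_act g (f t)
  map_grade f := by ext t; exact φ.map_grade (f t)

variable (G B) in
/-- The inclusion of the constant paths. -/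
def constPath : GStarHom G B C(unitInterval, B) where
  toHom :=
    { toFun := ContinuousMap.const _
      map_smul' := fun _ _ => rfl
      map_zero' := rfl
      map_add' := fun _ _ => rfl
      map_mul' := fun _ _ => rfl
      map_star' := fun _ => rfl }
  map_act _ _ := rfl
  map_grade _ := rfl

theorem pathMap_linearPath (φ : J →⋆ₙₐ[ℂ] B) (a b : J) :
    pathMap φ (linearPath a b) = linearPath (φ a) (φ b) := by
  ext t
  change φ (linearPath a b t) = _
  rw [linearPath_apply, map_add, map_smul, map_smul]
  rfl

theorem pathMap_injective {φ : J →⋆ₙₐ[ℂ] B} (hφ : Function.Injective φ) :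
    Function.Injective (pathMap φ) := fun f g h => by
  ext t
  exact hφ (DFunLike.congr_fun h t)

end PathAlgebra

/-! ### Uniqueness and naturality of extension morphisms -/

section ExtensionMorphism

variable {G : Type*} [Group G] {J B A : Type*}
  [NonUnitalCStarAlgebra J] [GradedGCStarAlgebra G J]
  [NonUnitalCStarAlgebra B] [GradedGCStarAlgebra G B]
  [NonUnitalCStarAlgebra A] [GradedGCStarAlgebra G A]

/-- Injectivity of `ι` pins down the representative on every elementary tensor, and `susp_hom_ext`
does the rest. -/
theorem IsExtensionMorphism.unique {ι : GStarHom G J B} {π : GStarHom G B A}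
    (hι : Function.Injective ι.toHom) (hπ : Function.Surjective π.toHom) {m : DirectedSet.{w}}
    {u : m → B} {σ τ : GStarHom G (Susp A) (SimplAlg m J)} (hσ : IsExtensionMorphism ι π u σ)
    (hτ : IsExtensionMorphism ι π u τ) : σ = τ := by
  refine GStarHom.ext (susp_hom_ext hπ _ _ fun f b => ?_)
  obtain ⟨F, hF, hσF⟩ := hσ f b
  obtain ⟨F', hF', hτF⟩ := hτ f b
  have h : F = F' := by
    ext x
    exact hι ((hF x).trans (hF' x).symm)
  rw [hσF, hτF, h]

/-- Affine extension turns reindexing of the net into composition with `|α|`, so the same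
representatives can be pulled back. -/
theorem IsExtensionMorphism.pullback {ι : GStarHom G J B} {π : GStarHom G B A}
    {m n : DirectedSet.{w}} {u : n → B} {σ : GStarHom G (Susp A) (SimplAlg n J)}
    (hσ : IsExtensionMorphism ι π u σ) (α : m → n) (hα : IsCofinalMap α) :
    IsExtensionMorphism ι π (fun i => u (α i)) ((cofinalPullback α hα).comp σ) := by
  intro f b
  obtain ⟨F, hF, hσF⟩ := hσ f b
  refine ⟨F.compContinuous (FullSimplex.map α), fun x => ?_, ?_⟩
  · rw [← FullSimplex.affineExt_map]
    exact hF _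
  · exact congrArg (cofinalPullback (G := G) (B := J) α hα).toHom hσF

end ExtensionMorphism

/-! ### Quasicentral approximate units -/

section Quasicentral

variable {G : Type*} [Group G] {J B A : Type*}
  [NonUnitalCStarAlgebra J] [GradedGCStarAlgebra G J]
  [NonUnitalCStarAlgebra B] [PartialOrder B] [GradedGCStarAlgebra G B]
  [NonUnitalCStarAlgebra A] [GradedGCStarAlgebra G A]

theorem IsQuasicentralApproxUnit.comp {J₀ : NonUnitalStarSubalgebra ℂ B} {m n : DirectedSet.{w}}
    {u : n → B} (hu : IsQuasicentralApproxUnit G J₀ u) {α : m → n} (hα : IsCofinalMap α) :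
    IsQuasicentralApproxUnit G J₀ fun i => u (α i) where
  mem _ := hu.mem _
  nonneg _ := hu.nonneg _
  norm_le_one _ := hu.norm_le_one _
  tendsto_mul j hj := (hu.tendsto_mul j hj).comp hα.tendsto_atTop
  tendsto_commutator b := (hu.tendsto_commutator b).comp hα.tendsto_atTop
  tendsto_act g := (hu.tendsto_act g).comp hα.tendsto_atTop
  tendsto_grade := hu.tendsto_grade.comp hα.tendsto_atTop

/-- A quasicentral approximate unit for `J₀` is an approximate unit for the closed span of
`J₀ J`. -/
theorem IsQuasicentralApproxUnit.tendsto_mul_of_mem_closure {J₀ : NonUnitalStarSubalgebra ℂ B}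
    {m : DirectedSet.{w}} {u : m → B} (hu : IsQuasicentralApproxUnit G J₀ u) (s : Set B) {b : B}
    (hb : b ∈ closure (Submodule.span ℂ {b : B | ∃ a ∈ J₀, ∃ i ∈ s, b = a * i} : Set B)) :
    Tendsto (fun i => ‖u i * b - b‖) atTop (𝓝 0) := by
  have hspan : ∀ y ∈ Submodule.span ℂ {b : B | ∃ a ∈ J₀, ∃ i ∈ s, b = a * i},
      Tendsto (fun i => u i * y - y) atTop (𝓝 0) := by
    intro y hy
    induction hy using Submodule.span_induction with
    | mem y hy =>
      obtain ⟨a, ha, i, -, rfl⟩ := hy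
      have h := (tendsto_zero_iff_norm_tendsto_zero.2 (hu.tendsto_mul a ha)).mul_const i
      rw [zero_mul] at h
      exact h.congr fun k => by rw [sub_mul, mul_assoc]
    | zero => simp
    | add x y _ _ hx hy =>
      have h := hx.add hy
      rw [add_zero] at h
      exact h.congr fun k => by rw [mul_add]; abel
    | smul c x _ hx =>
      have h := hx.const_smul c
      rw [smul_zero] at h
      exact h.congr fun k => by rw [mul_smul_comm, smul_sub]
  rw [Metric.tendsto_nhds]
  intro ε hε
  obtain ⟨y, hy, hby⟩ := Metric.mem_closure_iff.1 hb (ε / 3) (by positivity)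
  filter_upwards [Metric.tendsto_nhds.1 (hspan y hy) (ε / 3) (by positivity)] with i hi
  rw [dist_zero_right] at hi
  rw [dist_eq_norm] at hby
  rw [dist_zero_right, norm_norm]
  -- Approximating `b` by `y` costs at most `‖b - y‖` twice, uniformly in `i`, because the net is
  -- bounded by one.
  have h1 : u i * b - b = u i * (b - y) + (u i * y - y) - (b - y) := by
    rw [mul_sub]
    abel
  have h2 : ‖u i * (b - y)‖ ≤ ‖b - y‖ :=
    (norm_mul_le _ _).trans (mul_le_of_le_one_left (norm_nonneg _) (hu.norm_le_one i))
  have h3 := norm_sub_le (u i * (b - y) + (u i * y - y)) (b - y)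
  have h4 := norm_add_le (u i * (b - y)) (u i * y - y)
  rw [h1]
  linarith

/-- The linear path between two quasicentral approximate units over the same directed set induces a
homotopy between the extension morphisms. -/
theorem exists_extension_homotopy [StarOrderedRing B] (ι : GStarHom G J B) (π : GStarHom G B A)
    (hι : Function.Injective ι.toHom) (hπ : Function.Surjective π.toHom)
    (hexact : ∀ b : B, π.toHom b = 0 ↔ b ∈ Set.range ι.toHom)
    (J₀ : NonUnitalStarSubalgebra ℂ B)
    (hJ₀_le : ∀ b ∈ J₀, b ∈ Set.range ι.toHom)
    (hJ₀_nondeg : ∀ j : J, ι.toHom j ∈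
      closure (Submodule.span ℂ {b : B | ∃ a ∈ J₀, ∃ i : J, b = a * ι.toHom i} : Set B))
    (m : DirectedSet.{w}) (u v : m → B) (hu : IsQuasicentralApproxUnit G J₀ u)
    (hv : IsQuasicentralApproxUnit G J₀ v) :
    ∃ Φ : GStarHom G (Susp A) (SimplAlg m C(unitInterval, J)), ∀ t : unitInterval,
      IsExtensionMorphism ι π (fun i => linearPath (u i) (v i) t)
        ((AsympAlg.map (FullSimplex.tailFilter m) (evalPath G J t)).comp Φ) := by
  have hunit : ∀ {w : m → B}, IsQuasicentralApproxUnit G J₀ w → ∀ b, π.toHom b = 0 →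
      Tendsto (fun i => ‖w i * b - b‖) atTop (𝓝 0) := by
    intro w hw b hb
    obtain ⟨j, rfl⟩ := (hexact b).1 hb
    refine hw.tendsto_mul_of_mem_closure (Set.range ι.toHom) ?_
    simpa only [Set.exists_range_iff] using hJ₀_nondeg j
  have hnorm : ∀ j, ‖ι.toHom j‖ = ‖j‖ := NonUnitalStarAlgHom.norm_map ι.toHom hι
  choose a ha using fun i => hJ₀_le _ (hu.mem i)
  choose b hb using fun i => hJ₀_le _ (hv.mem i)
  have hsa : ∀ {w : m → B}, IsQuasicentralApproxUnit G J₀ w → ∀ {c : m → J},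
      (∀ i, ι.toHom (c i) = w i) → ∀ i, star (c i) = c i := fun hw c hc i =>
    hι (by rw [map_star, hc, (IsSelfAdjoint.of_nonneg (hw.nonneg i)).star_eq])
  let k : m → C(unitInterval, J) := fun i => linearPath (a i) (b i)
  have hιk : ∀ i, (pathGStarHom ι).toHom (k i) = linearPath (u i) (v i) := fun i =>
    (pathMap_linearPath _ _ _).trans (by rw [ha, hb])
  -- A crude bound suffices: it only serves to make the affine extension a bounded function.
  have hk_norm : ∀ i, ‖k i‖ ≤ 2 := fun i => by
    refine (norm_linearPath_le _ _).trans ?_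
    rw [← hnorm, ← hnorm, ha, hb]
    linarith [hu.norm_le_one i, hv.norm_le_one i]
  have hk_star : ∀ i, star (k i) = k i := fun i => by
    ext t
    change star (linearPath (a i) (b i) t) = linearPath (a i) (b i) t
    simp only [linearPath_apply, star_add, star_smul, hsa hu ha, hsa hv hb, Complex.star_def,
      Complex.conj_ofReal]
  let V : FullSimplex m →ᵇ C(unitInterval, J) :=
    BoundedContinuousFunction.ofNormedAddCommGroup (FullSimplex.affineExt k)
      (FullSimplex.continuous_affineExt k) 2 fun x => by
        have h := FullSimplex.affineExt_mem (convex_closedBall (0 : C(unitInterval, J)) 2) k x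
          fun i _ => by simpa using hk_norm i
        simpa using h
  have hVx : ∀ x, V x = FullSimplex.affineExt k x := fun _ => rfl
  have hV : ∀ x, IsSelfAdjoint (V x) := fun x => by
    rw [isSelfAdjoint_iff, hVx, FullSimplex.affineExt, Finsupp.sum, star_sum]
    refine Finset.sum_congr rfl fun i _ => ?_
    rw [star_smul, hk_star, Complex.star_def, Complex.conj_ofReal]
  let I : C(unitInterval, J) →ₗ[ℂ] C(unitInterval, B) :=
    { toFun := (pathGStarHom ι).toHom
      map_add' := map_add _
      map_smul' := map_smul _ }
  -- Stated for a general compatible pair of endomorphisms, so that the group action and the grading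
  -- are treated at once.
  have hact : ∀ φ : J →⋆ₙₐ[ℂ] J, ∀ φ' : B →⋆ₙₐ[ℂ] B, (∀ j, ι.toHom (φ j) = φ' (ι.toHom j)) →
      Tendsto (fun i => ‖φ' (u i) - u i‖) atTop (𝓝 0) →
      Tendsto (fun i => ‖φ' (v i) - v i‖) atTop (𝓝 0) →
      Tendsto (fun x => pathMap φ (V x) - V x) (FullSimplex.tailFilter m) (𝓝 0) := by
    intro φ φ' hφ hφu hφv
    let L : C(unitInterval, J) →ₗ[ℂ] C(unitInterval, J) :=
      { toFun := pathMap φ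
        map_add' := map_add _
        map_smul' := map_smul _ }
    have h := tendsto_linearPath_zero (a := fun i => φ (a i) - a i) (b := fun i => φ (b i) - b i)
      (hφu.congr fun i => by rw [← hnorm, map_sub, hφ, ha])
      (hφv.congr fun i => by rw [← hnorm, map_sub, hφ, hb])
    refine (FullSimplex.tendsto_affineExt h).congr fun x => ?_
    refine Eq.trans (congrArg (fun w => FullSimplex.affineExt w x) (funext fun i => ?_))
      (FullSimplex.map_affineExt (L - LinearMap.id) k x).symm
    change _ = pathMap φ (linearPath (a i) (b i)) - linearPath (a i) (b i)
    rw [pathMap_linearPath]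
    ext t
    simp only [linearPath_apply, ContinuousMap.sub_apply, smul_sub]
    abel
  obtain ⟨Φ, hΦ⟩ := exists_extension_morphism (l := FullSimplex.tailFilter m)
    (pathGStarHom ι) (constPath G B) π
    (pathMap_injective hι) hπ
    (fun f c => by
      -- The range of `ι` is the kernel of `π`, hence an ideal. Boundedness of the multiplication
      -- operator makes the product with a path in `J` again a continuous path in `J`.
      obtain ⟨R, hR⟩ := exists_right_mul ι.toHom hι c fun j => (hexact _).1 (by
        rw [map_mul, (hexact _).2 ⟨j, rfl⟩, zero_mul])
      refine ⟨⟨fun t => R (f t), R.continuous.comp f.continuous⟩, ?_⟩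
      ext t
      exact hR (f t))
    V hV
    (fun c => by
      -- The commutator with a constant path is linear in the other entry, so it commutes both with
      -- forming straight paths and with affine extension.
      have h := tendsto_linearPath_zero (hu.tendsto_commutator c) (hv.tendsto_commutator c)
      refine (FullSimplex.tendsto_affineExt h).congr fun x => ?_
      let d : C(unitInterval, B) := (constPath G B).toHom c
      refine Eq.trans (congrArg (fun w => FullSimplex.affineExt w x) (funext fun i => ?_))
        (FullSimplex.map_affineExt ((LinearMap.mulRight ℂ d - LinearMap.mulLeft ℂ d) ∘ₗ I) k
          x).symm
      change _ = (pathGStarHom ι).toHom (k i) * d - d * (pathGStarHom ι).toHom (k i)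
      rw [hιk]
      ext t
      change _ = linearPath (u i) (v i) t * c - c * linearPath (u i) (v i) t
      simp only [linearPath_apply, smul_sub, add_mul, mul_add, smul_mul_assoc, mul_smul_comm]
      abel)
    (fun c hc => by
      let d : C(unitInterval, B) := (constPath G B).toHom c
      have h := tendsto_linearPath_zero (hunit hu c hc) (hunit hv c hc)
      -- The map `w ↦ w * d - d` is affine but not linear, so the linear part `w ↦ w * d` is
      -- extended, with limit `d`, and `d` is subtracted afterwards.
      have h' : Tendsto (fun i => LinearMap.mulRight ℂ d (I (k i))) atTop (𝓝 d) := by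
        refine tendsto_sub_nhds_zero_iff.1 (h.congr fun i => ?_)
        change _ = (pathGStarHom ι).toHom (k i) * d - d
        rw [hιk]
        ext t
        change _ = linearPath (u i) (v i) t * c - c
        simp only [linearPath_apply, smul_sub]
        have hc' : ((1 - (t : ℝ) : ℝ) : ℂ) • c + ((t : ℝ) : ℂ) • c = c := by
          rw [← add_smul]
          simp
        refine Eq.trans ?_ (congrArg (linearPath (u i) (v i) t * c - ·) hc')
        simp only [linearPath_apply, add_mul, smul_mul_assoc]
        abel
      refine (tendsto_sub_nhds_zero_iff.2 (FullSimplex.tendsto_affineExt h')).congr fun x => ?_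
      exact congrArg (· - d) (FullSimplex.map_affineExt (LinearMap.mulRight ℂ d ∘ₗ I) k x).symm)
    (fun g => hact (gact g) (gact g) (ι.map_act g) (hu.tendsto_act g) (hv.tendsto_act g))
    (hact (gradeAut G) (gradeAut G) ι.map_grade hu.tendsto_grade hv.tendsto_grade)
  refine ⟨Φ, fun t f c => ?_⟩
  obtain ⟨F, hF, hΦF⟩ := hΦ f c
  refine ⟨bcfMap _ (evalPath G J t).toHom F, fun x => ?_, ?_⟩
  -- Evaluation at `t` commutes with functional calculus and with affine extension, which turns the
  -- path-valued formula into the formula for the net at time `t`.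
  · have h1 := congrArg (evalPath G B t).toHom (hF x)
    rw [map_mul, map_intervalCalc _ f ((hV x).map _)] at h1
    refine h1.trans (congrArg (fun w => intervalCalc f w * c) ?_)
    let L : C(unitInterval, J) →ₗ[ℂ] B :=
      { toFun := fun f => (evalPath G B t).toHom ((pathGStarHom ι).toHom f)
        map_add' := fun _ _ => by rw [map_add, map_add]
        map_smul' := fun _ _ => by rw [map_smul, map_smul]; rfl }
    refine (FullSimplex.map_affineExt L k x).trans
      (congrArg (fun w => FullSimplex.affineExt w x) (funext fun i => ?_))
    exact congrArg (evalPath G B t).toHom (hιk i)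
  · exact congrArg (AsympAlg.map (FullSimplex.tailFilter m) (evalPath G J t)).toHom hΦF

end Quasicentral

/-! ### Classes in the direct limit and products of directed sets -/

theorem SimplMor.mk_pullback {G : Type*} [Group G] {A B : Type*} [NonUnitalCStarAlgebra A]
    [GradedGCStarAlgebra G A] [NonUnitalCStarAlgebra B] [GradedGCStarAlgebra G B]
    {m n : DirectedSet.{w}} (α : m → n) (hα : IsCofinalMap α)
    (φ : GStarHom G A (SimplAlg n B)) :
    SimplMor.mk ((cofinalPullback α hα).comp φ) = SimplMor.mk φ :=
  (Quot.sound ⟨α, hα, rfl⟩).symm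

theorem SimplMor.mk_eq_of_homotopic {G : Type*} [Group G] {A B : Type*} [NonUnitalCStarAlgebra A]
    [GradedGCStarAlgebra G A] [NonUnitalCStarAlgebra B] [GradedGCStarAlgebra G B]
    {m : DirectedSet.{w}} {φ₀ φ₁ : GStarHom G A (SimplAlg m B)} (h : SimplHomotopic φ₀ φ₁) :
    SimplMor.mk φ₀ = SimplMor.mk φ₁ :=
  congrArg (fun c => (Quot.mk _ ⟨m, c⟩ : SimplMor G A B)) (Quot.sound h)

/-- The product of two directed sets. -/
def DirectedSet.prod (m n : DirectedSet.{w}) : DirectedSet.{w} where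
  carrier := m × n
  directed := ⟨fun a b => by
    obtain ⟨i, hi⟩ := exists_ge_ge a.1 b.1
    obtain ⟨j, hj⟩ := exists_ge_ge a.2 b.2
    exact ⟨(i, j), ⟨hi.1, hj.1⟩, ⟨hi.2, hj.2⟩⟩⟩

theorem DirectedSet.isCofinalMap_fst (m n : DirectedSet.{w}) :
    IsCofinalMap (m := m.prod n) (n := m) Prod.fst := fun i =>
  ⟨(i, Classical.arbitrary n), fun _ hk => hk.1⟩

theorem DirectedSet.isCofinalMap_snd (m n : DirectedSet.{w}) :
    IsCofinalMap (m := m.prod n) (n := n) Prod.snd := fun j =>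
  ⟨(Classical.arbitrary m, j), fun _ hk => hk.2⟩

end

/-! ### Existence, uniqueness and independence of the extension morphism -/

theorem mainTheorem8 {G : Type*} [Group G] {J B A : Type*}
    [NonUnitalCStarAlgebra J] [GradedGCStarAlgebra G J]
    [NonUnitalCStarAlgebra B] [PartialOrder B] [StarOrderedRing B] [GradedGCStarAlgebra G B]
    [NonUnitalCStarAlgebra A] [GradedGCStarAlgebra G A]
    (ι : GStarHom G J B) (π : GStarHom G B A)
    (hι : Function.Injective ι.toHom) (hπ : Function.Surjective π.toHom)
    (hexact : ∀ b : B, π.toHom b = 0 ↔ b ∈ Set.range ι.toHom)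
    (J₀ : NonUnitalStarSubalgebra ℂ B) (hJ₀_closed : IsClosed (J₀ : Set B))
    (hJ₀_le : ∀ b ∈ J₀, b ∈ Set.range ι.toHom)
    (hJ₀_act : ∀ (g : G), ∀ b ∈ J₀, gact g b ∈ J₀)
    (hJ₀_grade : ∀ b ∈ J₀, gradeAut G b ∈ J₀)
    (hJ₀_nondeg : ∀ j : J, ι.toHom j ∈
      closure (Submodule.span ℂ {b : B | ∃ a ∈ J₀, ∃ i : J, b = a * ι.toHom i} : Set B)) :
    (∀ (m : DirectedSet.{w}) (u : m → B), IsQuasicentralApproxUnit G J₀ u →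
      Continuous (FullSimplex.affineExt u) ∧
      ∃! σ : GStarHom G (Susp A) (SimplAlg m J), IsExtensionMorphism ι π u σ) ∧
    (∀ (m n : DirectedSet.{w}) (u : m → B) (v : n → B),
      IsQuasicentralApproxUnit G J₀ u → IsQuasicentralApproxUnit G J₀ v →
      ∀ (σ : GStarHom G (Susp A) (SimplAlg m J)) (τ : GStarHom G (Susp A) (SimplAlg n J)),
        IsExtensionMorphism ι π u σ → IsExtensionMorphism ι π v τ →
        SimplMor.mk σ = SimplMor.mk τ) := by
  refine ⟨fun m u hu => ⟨FullSimplex.continuous_affineExt u, ?_⟩, ?_⟩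
  -- The homotopy from `u` to itself runs along constant paths up to affine extension; evaluating it
  -- at `0` gives the required morphism.
  · obtain ⟨Φ, hΦ⟩ := exists_extension_homotopy ι π hι hπ hexact J₀ hJ₀_le hJ₀_nondeg m u u hu hu
    have h0 := hΦ 0
    simp only [linearPath_zero] at h0
    exact ⟨_, h0, fun τ hτ => hτ.unique hι hπ h0⟩
  · intro m n u v hu hv σ τ hσ hτ
    have hα := m.isCofinalMap_fst n
    have hβ := m.isCofinalMap_snd n
    -- Both projections from the product are cofinal, so the two nets become comparable over a
    -- common index set without changing their classes in the limit.
    obtain ⟨Φ, hΦ⟩ := exists_extension_homotopy ι π hι hπ hexact J₀ hJ₀_le hJ₀_nondeg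
      (m.prod n) (fun i => u i.1) (fun i => v i.2) (hu.comp hα) (hv.comp hβ)
    have h0 := hΦ 0
    have h1 := hΦ 1
    simp only [linearPath_zero] at h0
    simp only [linearPath_one] at h1
    rw [← SimplMor.mk_pullback _ hα σ, ← SimplMor.mk_pullback _ hβ τ]
    exact SimplMor.mk_eq_of_homotopic
      ⟨Φ, h0.unique hι hπ (hσ.pullback _ hα), h1.unique hι hπ (hτ.pullback _ hβ)⟩
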